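/- Let $(M,g)$ be a smooth Riemannian manifold of dimension $m\ge 1$ with boundary $\partial M$, let $\nabla$ and $R$ be its Levi-Civita connection and its curvature tensor, viewed as a $(0,4)$-tensor, and let $\bar\nabla$ and $\bar R$ be the Levi-Civita connection and the curvature $(0,4)$-tensor of $\partial M$ with the induced metric. Let $\nu$ be the unit inward normal field of $\partial M$ and $l(X,Y)=g(\nabla_XY,\nu)$ the second fundamental form. For a $(0,s)$-tensor $S$ on $\partial M$, $s\ge1$, let $S^{*_1}$ be the $(1,s-1)$-tensor on $\partial M$ with $g(S^{*_1}(v_2,\dots,v_s),v_1)=S(v_1,\dots,v_s)$. Norms of covariant tensors at a point are the Euclidean (Hilbert–Schmidt) norms induced by the metric. Let $k\ge 0$ be an integer. (1) $\bar\nabla^k\bar R$ is a finite linear combination with integer coefficients of tensors on $\partial M$, each of which is obtained by tensor products, (possibly iterated) contractions, permutations of the entries and restriction of entries from $TM|_{\partial M}$ to $T\partial M$, from the building blocks (i) $\nabla^jR$ for $0\le j\le k$; (ii) $\bar\nabla^jl$ for $0\le j\le k$; (iii) $(\bar\nabla^jl)^{*_1}$ for $0\le j<k-1$; (iv) $\nu$.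 Here the contractions insert $\nu$ or one of the tensors (iii) into an entry of a covariant tensor ($\nu$ only into entries in $TM|_{\partial M}$). The formal expression can be chosen to depend on $k$ only, not on $m$ or $(M,g)$. (2) For every $C\in\mathbb R$ there is $D\in\mathbb R$, depending on $k$ and $C$ only, such that for every $(M,g)$ as above and every $p\in\partial M$: if $|\nabla^jR|(p)\le C$ and $|\bar\nabla^jl|(p)\le C$ for $0\le j\le k$, then $|\bar\nabla^k\bar R|(p)\le D$. -/

import Mathlib

open scoped Manifold ContDiff Bundle

noncomputable section

namespace BoundaryGeometry

/-! ### Tensor calculus in coordinates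

A covariant tensor field of rank `r` on a subset of `ℝᵈ` is given by its components
`T_{i₁ … iᵣ}` with respect to the coordinate vector fields `∂₁, …, ∂_d`. -/

/-- Coordinate space `ℝᵈ`. -/
abbrev Coord (d : ℕ) : Type := EuclideanSpace ℝ (Fin d)

/-- The components of a `(0, r)`-tensor field in `d` coordinates. -/
abbrev TField (d r : ℕ) : Type := Coord d → (Fin r → Fin d) → ℝ

/-- The partial derivative `∂ᵢ f` at `x`, for a function `f` on the set `S` (a half-space, in which
case the derivative is one-sided at the boundary, or the whole coordinate space). -/
def pderiv {d : ℕ} (S : Set (Coord d)) (f : Coord d → ℝ) (i : Fin d) (x : Coord d) : ℝ :=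
  fderivWithin ℝ f S x (EuclideanSpace.single i 1)

/-- The Christoffel symbols `Γⁱⱼₖ` of the Levi-Civita connection of the metric `g`:
`∇_{∂ⱼ} ∂ₖ = ∑ᵢ Γⁱⱼₖ ∂ᵢ`. -/
def christoffel {d : ℕ} (S : Set (Coord d)) (g : Coord d → Matrix (Fin d) (Fin d) ℝ)
    (i j k : Fin d) (x : Coord d) : ℝ :=
  (1 / 2 : ℝ) * ∑ a, (g x)⁻¹ i a *
    (pderiv S (fun y => g y a k) j x + pderiv S (fun y => g y a j) k x
      - pderiv S (fun y => g y j k) a x)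

/-- The curvature tensor `R_{ijkl} = g(R(∂ₖ, ∂ₗ) ∂ⱼ, ∂ᵢ)` of the Levi-Civita connection of `g`, where
`R(X, Y) Z = ∇_X ∇_Y Z - ∇_Y ∇_X Z - ∇_{[X, Y]} Z`. -/
def curvature {d : ℕ} (S : Set (Coord d)) (g : Coord d → Matrix (Fin d) (Fin d) ℝ) :
    TField d 4 := fun x I =>
  ∑ b, g x (I 0) b *
    (pderiv S (christoffel S g b (I 3) (I 1)) (I 2) x
      - pderiv S (christoffel S g b (I 2) (I 1)) (I 3) x
      + ∑ a, (christoffel S g b (I 2) a x * christoffel S g a (I 3) (I 1) x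
          - christoffel S g b (I 3) a x * christoffel S g a (I 2) (I 1) x))

/-- The covariant derivative of a `(0, r)`-tensor field with respect to the Levi-Civita connection
of `g`. The new entry, the direction of differentiation, is the last one. -/
def covDeriv {d r : ℕ} (S : Set (Coord d)) (g : Coord d → Matrix (Fin d) (Fin d) ℝ)
    (T : TField d r) : TField d (r + 1) := fun x I =>
  pderiv S (fun y => T y (fun s => I s.castSucc)) (I (Fin.last r)) x
    - ∑ s : Fin r, ∑ a, christoffel S g a (I (Fin.last r)) (I s.castSucc) x *
        T x (Function.update (fun t => I t.castSucc) s a)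

/-- The iterated covariant derivative `∇ʲ R` of the curvature tensor. -/
def nablaCurvature {d : ℕ} (S : Set (Coord d)) (g : Coord d → Matrix (Fin d) (Fin d) ℝ) :
    (j : ℕ) → TField d (j + 4)
  | 0 => curvature S g
  | j + 1 => covDeriv S g (nablaCurvature S g j)

/-- The norm of a covariant tensor at a point, induced by the inner product `g` at this point:
`|T|² = ∑ g^{i₁ j₁} ⋯ g^{iᵣ jᵣ} T_{i₁ … iᵣ} T_{j₁ … jᵣ}`. -/
def tensorNorm {d r : ℕ} (g : Matrix (Fin d) (Fin d) ℝ) (T : (Fin r → Fin d) → ℝ) : ℝ :=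
  Real.sqrt (∑ I, ∑ J, (∏ s, g⁻¹ (I s) (J s)) * T I * T J)

/-- The `(1, r)`-tensor `S^{*₁}` of a `(0, r + 1)`-tensor `S`, determined by
`g(S^{*₁}(v₂, …), v₁) = S(v₁, v₂, …)`. The first argument is the upper index. -/
def sharp {d r : ℕ} (g : Matrix (Fin d) (Fin d) ℝ) (T : (Fin (r + 1) → Fin d) → ℝ)
    (i : Fin d) (J : Fin r → Fin d) : ℝ :=
  ∑ c, g⁻¹ i c * T (Fin.cons c J)

/-! ### Metrics on the half-space `{y | 0 ≤ y₀}` in `ℝⁿ⁺¹` and the boundary `{y | y₀ = 0}`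

The boundary has the coordinates `y₁, …, yₙ`, so that the coordinate vector field `∂ₐ` of the
boundary, `a : Fin n`, is the restriction of `∂_{a.succ}`. -/

/-- The half-space `{y | 0 ≤ y₀}`. -/
def halfSpace (n : ℕ) : Set (Coord (n + 1)) := {y | 0 ≤ y 0}

/-- The inclusion of the boundary `y₀ = 0` of the half-space. -/
def bdryIncl {n : ℕ} (z : Coord n) : Coord (n + 1) :=
  WithLp.toLp 2 (Fin.cons 0 (fun a => z a))

/-- The metric induced on the boundary. -/
def bdryMetric {n : ℕ} (g : Coord (n + 1) → Matrix (Fin (n + 1)) (Fin (n + 1)) ℝ) :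
    Coord n → Matrix (Fin n) (Fin n) ℝ := fun z =>
  Matrix.of fun a b => g (bdryIncl z) a.succ b.succ

/-- The components of the unit inward normal vector field, `νⁱ = g^{0i} / √g^{00}`. -/
def normal {n : ℕ} (g : Coord (n + 1) → Matrix (Fin (n + 1)) (Fin (n + 1)) ℝ)
    (z : Coord n) (i : Fin (n + 1)) : ℝ :=
  (g (bdryIncl z))⁻¹ 0 i / Real.sqrt ((g (bdryIncl z))⁻¹ 0 0)

/-- The second fundamental form of the boundary, `l(X, Y) = g(∇_X Y, ν)`. -/
def secondFF {n : ℕ} (g : Coord (n + 1) → Matrix (Fin (n + 1)) (Fin (n + 1)) ℝ) :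
    TField n 2 := fun z I =>
  ∑ i, ∑ j, christoffel (halfSpace n) g i (I 0).succ (I 1).succ (bdryIncl z) *
    g (bdryIncl z) i j * normal g z j

/-- The iterated covariant derivative of the second fundamental form, with respect to the
Levi-Civita connection of the boundary. -/
def nablaSecondFF {n : ℕ} (g : Coord (n + 1) → Matrix (Fin (n + 1)) (Fin (n + 1)) ℝ) :
    (j : ℕ) → TField n (j + 2)
  | 0 => secondFF g
  | j + 1 => covDeriv Set.univ (bdryMetric g) (nablaSecondFF g j)

/-! ### Universal tensor expressions -/

/-- Formal expressions of order `k`, built by tensor products, permutations, contractions and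
restriction to the boundary from the following blocks: `∇ʲ R` with `j ≤ k`, `∇̄ʲ l` with `j ≤ k`,
`(∇̄ʲ l)^{*₁}` with `j < k - 1`, and `ν`.

An expression in `TensorExpr k a b` stands for a covariant tensor along `∂M` that has `a` entries in
`TM` and `b` entries in `T∂M`. A contraction puts a vector-valued tensor into the last entry. -/
inductive TensorExpr (k : ℕ) : ℕ → ℕ → Type
  /-- the block `∇ʲ R` -/
  | nablaR (j : ℕ) (hj : j ≤ k) : TensorExpr k (j + 4) 0
  /-- the block `∇̄ʲ l` -/
  | nablaL (j : ℕ) (hj : j ≤ k) : TensorExpr k 0 (j + 2)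
  /-- tensor product -/
  | tensor {a b a' b' : ℕ} (s : TensorExpr k a b) (t : TensorExpr k a' b') :
      TensorExpr k (a + a') (b + b')
  /-- permutation of the entries -/
  | perm {a b : ℕ} (σ : Equiv.Perm (Fin a)) (τ : Equiv.Perm (Fin b)) (t : TensorExpr k a b) :
      TensorExpr k a b
  /-- restriction of the last entry in `TM` to `T∂M` -/
  | restrict {a b : ℕ} (t : TensorExpr k (a + 1) b) : TensorExpr k a (b + 1)
  /-- contraction of the last entry in `TM` with `ν` -/
  | contractNormal {a b : ℕ} (t : TensorExpr k (a + 1) b) : TensorExpr k a b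
  /-- contraction of the last entry in `TM` with `(∇̄ʲ l)^{*₁}` -/
  | contractAmbient {a b : ℕ} (j : ℕ) (hj : j + 1 < k) (t : TensorExpr k (a + 1) b) :
      TensorExpr k a (b + (j + 1))
  /-- contraction of the last entry in `T∂M` with `(∇̄ʲ l)^{*₁}` -/
  | contractBdry {a b : ℕ} (j : ℕ) (hj : j + 1 < k) (t : TensorExpr k a (b + 1)) :
      TensorExpr k a (b + (j + 1))

/-- The components at the boundary point `z` of the tensor that an expression stands for, for the
metric `g` on the half-space. The first multi-index belongs to the entries in `TM`, the second one
to the entries in `T∂M`. -/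
def TensorExpr.eval {k n : ℕ} (g : Coord (n + 1) → Matrix (Fin (n + 1)) (Fin (n + 1)) ℝ)
    (z : Coord n) : {a b : ℕ} → TensorExpr k a b → (Fin a → Fin (n + 1)) → (Fin b → Fin n) → ℝ
  | _, _, .nablaR j _, I, _ => nablaCurvature (halfSpace n) g j (bdryIncl z) I
  | _, _, .nablaL j _, _, J => nablaSecondFF g j z J
  | _, _, .tensor (a := a) (b := b) (a' := a') (b' := b') s t, I, J =>
      s.eval g z (fun i => I (Fin.castAdd a' i)) (fun i => J (Fin.castAdd b' i)) *
        t.eval g z (fun i => I (Fin.natAdd a i)) (fun i => J (Fin.natAdd b i))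
  | _, _, .perm σ τ t, I, J => t.eval g z (fun i => I (σ i)) (fun i => J (τ i))
  | _, _, .restrict (b := b) t, I, J =>
      t.eval g z (Fin.snoc I (J (Fin.last b)).succ) (fun i => J i.castSucc)
  | _, _, .contractNormal t, I, J => ∑ i, t.eval g z (Fin.snoc I i) J * normal g z i
  | _, _, .contractAmbient (b := b) j _ t, I, J =>
      ∑ c : Fin n, t.eval g z (Fin.snoc I c.succ) (fun i => J (Fin.castAdd (j + 1) i)) *
        sharp (bdryMetric g z) (nablaSecondFF g j z) c (fun i => J (Fin.natAdd b i))
  | _, _, .contractBdry (b := b) j _ t, I, J =>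
      ∑ c : Fin n, t.eval g z I (Fin.snoc (fun i => J (Fin.castAdd (j + 1) i)) c) *
        sharp (bdryMetric g z) (nablaSecondFF g j z) c (fun i => J (Fin.natAdd b i))

/-! ### Riemannian manifolds with boundary -/

section Manifold

variable {n : ℕ} {M : Type*} [TopologicalSpace M] [ChartedSpace (EuclideanHalfSpace (n + 1)) M]

/-- The coordinate vector field `∂ᵢ` of the chart `φ`, at the point with coordinates `y`. -/
def coordVec (φ : OpenPartialHomeomorph M (EuclideanHalfSpace (n + 1))) (i : Fin (n + 1))
    (y : Coord (n + 1)) : TangentSpace (𝓡∂ (n + 1)) ((φ.extend (𝓡∂ (n + 1))).symm y) :=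
  mfderivWithin 𝓘(ℝ, Coord (n + 1)) (𝓡∂ (n + 1)) (φ.extend (𝓡∂ (n + 1))).symm (halfSpace n) y
    (EuclideanSpace.single i (1 : ℝ) : Coord (n + 1))

/-- The components `g_{ij} = g(∂ᵢ, ∂ⱼ)` of the Riemannian metric in the chart `φ`. -/
def chartMetric [Bundle.RiemannianBundle (fun x : M => TangentSpace (𝓡∂ (n + 1)) x)]
    (φ : OpenPartialHomeomorph M (EuclideanHalfSpace (n + 1))) :
    Coord (n + 1) → Matrix (Fin (n + 1)) (Fin (n + 1)) ℝ := fun y =>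
  Matrix.of fun i j => inner ℝ (coordVec φ i y) (coordVec φ j y)

/-- The boundary coordinates `(y₁, …, yₙ)` of the point `p` in the chart `φ`; if `p` is a boundary
point, then `y₀ = 0`. -/
def bdryCoord (φ : OpenPartialHomeomorph M (EuclideanHalfSpace (n + 1))) (p : M) : Coord n :=
  WithLp.toLp 2 fun a => φ.extend (𝓡∂ (n + 1)) p a.succ

end Manifold

end BoundaryGeometry

end

/-! The Gauss equation (`curvature_bdryMetric`) writes `R̄` as the restriction of `R` plus products
of two factors `l`; this expression is then differentiated `k` times. The differentiation takes
place among tensors along `∂M` with entries in `TM` and in `T∂M`, with the derivative `mixedDeriv`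
that uses both Levi-Civita connections. It obeys the Leibniz rule and commutes with permutations.
Two operations fail to be parallel. By the Gauss formula (`christoffel_tangent`), restricting an
entry to `T∂M` adds a term in which this entry is contracted with `ν` and multiplied by `l`
(`mixedDeriv_restrictLast`). By the Weingarten formula (`nablaNormal_eq`), `∇ν = -l^{*₁}`, so a
contraction with `ν` adds a contraction with `l^{*₁}` (`mixedDeriv_contractNormal`). Raising an
index commutes with `∇̄` (`pderiv_sharp`), so a derivative turns `(∇̄ʲ l)^{*₁}` into `(∇̄ʲ⁺¹
l)^{*₁}`. Hence the derivative of an expression is an integer combination of expressions of the next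
order (`isExpr_familyDeriv_eval`).

The restriction `j < k - 1` on raised blocks is a count of derivatives: the Gauss equation contains
no `ν`, the first derivative can create `ν`, the second can create `l^{*₁}`, and each further
derivative raises `j` by at most one. The induction carries this count as the alternative `1 ≤ k ∨
t.NormalFree`.

For the norm bound, components are taken in the orthonormal frame made of `ν` and an orthonormal
frame of `T∂M`. There, products are multiplicative for the norm, permutations preserve it,
restriction and contraction with `ν` merely select components, and contraction with a raised tensor
is controlled by Cauchy–Schwarz. The resulting constant depends on the expression and on `C`, never
on the dimension (`exists_isNormBound_eval`).

All of this is local, for a metric on a relatively open part of a half-space (`IsMetricOn`), with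
the expression chosen before the dimension and the metric. A chart of `M` provides such a metric
(`isMetricOn_chartMetric`), and it sends boundary points to `y₀ = 0`
(`extend_apply_zero_of_mem_boundary`). -/

namespace BoundaryGeometry

/-! ### Partial derivatives -/

section PartialDerivatives

variable {d : ℕ} {S U : Set (Coord d)} {f f' : Coord d → ℝ} {x : Coord d} (i : Fin d)

theorem differentiableWithinAt_of_contDiffOn (hU : IsOpen U) (hf : ContDiffOn ℝ ∞ f (S ∩ U))
    (hx : x ∈ S ∩ U) : DifferentiableWithinAt ℝ f S x :=
  (differentiableWithinAt_inter (hU.mem_nhds hx.2)).1 (hf.differentiableOn (by simp) x hx)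

theorem contDiffOn_pderiv (hS : UniqueDiffOn ℝ S) (hU : IsOpen U)
    (hf : ContDiffOn ℝ ∞ f (S ∩ U)) : ContDiffOn ℝ ∞ (pderiv S f i) (S ∩ U) := by
  have h : ContDiffOn ℝ ∞ (fderivWithin ℝ f (S ∩ U)) (S ∩ U) :=
    hf.fderivWithin (hS.inter hU) (by simp)
  refine (h.clm_apply (contDiffOn_const (c := EuclideanSpace.single i (1 : ℝ)))).congr fun y hy => ?_
  rw [pderiv, fderivWithin_inter (hU.mem_nhds hy.2)]

theorem pderiv_congr (hU : IsOpen U) (h : ∀ y ∈ S ∩ U, f y = f' y) (hx : x ∈ S ∩ U) :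
    pderiv S f i x = pderiv S f' i x := by
  rw [pderiv, pderiv, ← fderivWithin_inter (hU.mem_nhds hx.2),
    ← fderivWithin_inter (f := f') (hU.mem_nhds hx.2), fderivWithin_congr h (h x hx)]

theorem pderiv_const (c : ℝ) : pderiv S (fun _ => c) i x = 0 := by
  simp [pderiv]

theorem pderiv_add (hS : UniqueDiffWithinAt ℝ S x) (hf : DifferentiableWithinAt ℝ f S x)
    (hf' : DifferentiableWithinAt ℝ f' S x) :
    pderiv S (fun y => f y + f' y) i x = pderiv S f i x + pderiv S f' i x := by
  simp [pderiv, fderivWithin_fun_add hS hf hf']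

theorem pderiv_mul (hS : UniqueDiffWithinAt ℝ S x) (hf : DifferentiableWithinAt ℝ f S x)
    (hf' : DifferentiableWithinAt ℝ f' S x) :
    pderiv S (fun y => f y * f' y) i x = pderiv S f i x * f' x + f x * pderiv S f' i x := by
  simp [pderiv, fderivWithin_fun_mul hS hf hf']
  ring

theorem pderiv_const_mul (hS : UniqueDiffWithinAt ℝ S x) (hf : DifferentiableWithinAt ℝ f S x)
    (c : ℝ) : pderiv S (fun y => c * f y) i x = c * pderiv S f i x := by
  rw [pderiv_mul i hS (differentiableWithinAt_const c) hf, pderiv_const]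
  ring

theorem pderiv_sum {ι : Type*} (s : Finset ι) {F : ι → Coord d → ℝ}
    (hS : UniqueDiffWithinAt ℝ S x) (hF : ∀ a ∈ s, DifferentiableWithinAt ℝ (F a) S x) :
    pderiv S (fun y => ∑ a ∈ s, F a y) i x = ∑ a ∈ s, pderiv S (F a) i x := by
  simp [pderiv, fderivWithin_fun_sum hS hF]

theorem pderiv_sum_mul {ι : Type*} (s : Finset ι) {F G : ι → Coord d → ℝ}
    (hS : UniqueDiffWithinAt ℝ S x) (hF : ∀ a ∈ s, DifferentiableWithinAt ℝ (F a) S x)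
    (hG : ∀ a ∈ s, DifferentiableWithinAt ℝ (G a) S x) :
    pderiv S (fun y => ∑ a ∈ s, F a y * G a y) i x =
      ∑ a ∈ s, pderiv S (F a) i x * G a x + ∑ a ∈ s, F a x * pderiv S (G a) i x := by
  rw [pderiv_sum i s hS fun a ha => (hF a ha).fun_mul (hG a ha), ← Finset.sum_add_distrib]
  exact Finset.sum_congr rfl fun a ha => pderiv_mul i hS (hF a ha) (hG a ha)

end PartialDerivatives

/-! ### The Levi-Civita connection in coordinates -/

/-- `g` is a smooth Riemannian metric on `S ∩ U`, where `U` is open. -/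
structure IsMetricOn {d : ℕ} (S U : Set (Coord d)) (g : Coord d → Matrix (Fin d) (Fin d) ℝ) :
    Prop where
  uniqueDiffOn : UniqueDiffOn ℝ S
  isOpen : IsOpen U
  contDiffOn : ∀ i j, ContDiffOn ℝ ∞ (fun y => g y i j) (S ∩ U)
  posDef : ∀ y ∈ S ∩ U, (g y).PosDef

theorem contDiffOn_det {d m : ℕ} {W : Set (Coord d)} {A : Coord d → Matrix (Fin m) (Fin m) ℝ}
    (hA : ∀ i j, ContDiffOn ℝ ∞ (fun y => A y i j) W) :
    ContDiffOn ℝ ∞ (fun y => (A y).det) W := by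
  simp only [Matrix.det_apply, Units.smul_def, zsmul_eq_mul]
  exact ContDiffOn.sum fun σ _ => contDiffOn_const.mul (contDiffOn_prod fun i _ => hA _ _)

/-- Cramer's rule: an entry of the inverse is a cofactor divided by the determinant. -/
theorem contDiffOn_inv_apply {d m : ℕ} {W : Set (Coord d)}
    {A : Coord d → Matrix (Fin m) (Fin m) ℝ} (hA : ∀ i j, ContDiffOn ℝ ∞ (fun y => A y i j) W)
    (hdet : ∀ y ∈ W, (A y).det ≠ 0) (i j : Fin m) :
    ContDiffOn ℝ ∞ (fun y => (A y)⁻¹ i j) W := by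
  have h : ContDiffOn ℝ ∞ (fun y => (A y).det⁻¹ * (A y).adjugate i j) W := by
    refine ((contDiffOn_det hA).inv hdet).mul ?_
    simp only [Matrix.adjugate_apply]
    refine contDiffOn_det fun a b => ?_
    -- An adjugate entry is the determinant after row `j` is replaced by a constant basis vector;
    -- the other rows are unchanged.
    by_cases hab : a = j
    · subst hab
      simpa using contDiffOn_const
    · simpa [Matrix.updateRow_ne hab] using hA a b
  refine h.congr fun y _ => ?_
  simp [Matrix.inv_def, Ring.inverse_eq_inv']

namespace IsMetricOn

variable {d : ℕ} {S U : Set (Coord d)} {g : Coord d → Matrix (Fin d) (Fin d) ℝ} {x : Coord d}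

theorem uniqueDiffWithinAt (h : IsMetricOn S U g) (hx : x ∈ S ∩ U) : UniqueDiffWithinAt ℝ S x :=
  h.uniqueDiffOn x hx.1

theorem symm (h : IsMetricOn S U g) (hx : x ∈ S ∩ U) (i j : Fin d) : g x i j = g x j i := by
  simpa using ((h.posDef x hx).isHermitian.apply j i)

theorem det_ne_zero (h : IsMetricOn S U g) (hx : x ∈ S ∩ U) : (g x).det ≠ 0 :=
  (h.posDef x hx).det_pos.ne'

theorem isUnit_det (h : IsMetricOn S U g) (hx : x ∈ S ∩ U) : IsUnit (g x).det :=
  (h.det_ne_zero hx).isUnit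

theorem inv_symm (h : IsMetricOn S U g) (hx : x ∈ S ∩ U) (i j : Fin d) :
    (g x)⁻¹ i j = (g x)⁻¹ j i := by
  simpa using ((h.posDef x hx).isHermitian.inv.apply j i)

theorem mul_inv_apply (h : IsMetricOn S U g) (hx : x ∈ S ∩ U) (i j : Fin d) :
    ∑ a, g x i a * (g x)⁻¹ a j = if i = j then 1 else 0 := by
  rw [← Matrix.mul_apply, Matrix.mul_nonsing_inv _ (h.isUnit_det hx), Matrix.one_apply]

theorem contDiffOn_inv (h : IsMetricOn S U g) (i j : Fin d) :
    ContDiffOn ℝ ∞ (fun y => (g y)⁻¹ i j) (S ∩ U) :=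
  contDiffOn_inv_apply h.contDiffOn (fun _ hy => h.det_ne_zero hy) i j

theorem contDiffOn_pderiv (h : IsMetricOn S U g) {f : Coord d → ℝ}
    (hf : ContDiffOn ℝ ∞ f (S ∩ U)) (i : Fin d) : ContDiffOn ℝ ∞ (pderiv S f i) (S ∩ U) :=
  BoundaryGeometry.contDiffOn_pderiv i h.uniqueDiffOn h.isOpen hf

theorem differentiableWithinAt (h : IsMetricOn S U g) {f : Coord d → ℝ}
    (hf : ContDiffOn ℝ ∞ f (S ∩ U)) (hx : x ∈ S ∩ U) : DifferentiableWithinAt ℝ f S x :=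
  differentiableWithinAt_of_contDiffOn h.isOpen hf hx

theorem contDiffOn_christoffel (h : IsMetricOn S U g) (i j k : Fin d) :
    ContDiffOn ℝ ∞ (christoffel S g i j k) (S ∩ U) := by
  refine contDiffOn_const.mul (ContDiffOn.sum fun a _ => (h.contDiffOn_inv _ _).mul ?_)
  exact ((h.contDiffOn_pderiv (h.contDiffOn _ _) _).add
    (h.contDiffOn_pderiv (h.contDiffOn _ _) _)).sub (h.contDiffOn_pderiv (h.contDiffOn _ _) _)

theorem contDiffOn_curvature (h : IsMetricOn S U g) (I : Fin 4 → Fin d) :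
    ContDiffOn ℝ ∞ (fun y => curvature S g y I) (S ∩ U) := by
  refine ContDiffOn.sum fun a _ => (h.contDiffOn _ _).mul (ContDiffOn.add ?_ ?_)
  · exact (h.contDiffOn_pderiv (h.contDiffOn_christoffel _ _ _) _).sub
      (h.contDiffOn_pderiv (h.contDiffOn_christoffel _ _ _) _)
  · exact ContDiffOn.sum fun b _ =>
      ((h.contDiffOn_christoffel _ _ _).mul (h.contDiffOn_christoffel _ _ _)).sub
        ((h.contDiffOn_christoffel _ _ _).mul (h.contDiffOn_christoffel _ _ _))

theorem contDiffOn_covDeriv (h : IsMetricOn S U g) {r : ℕ} {T : TField d r}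
    (hT : ∀ I, ContDiffOn ℝ ∞ (fun y => T y I) (S ∩ U)) (I : Fin (r + 1) → Fin d) :
    ContDiffOn ℝ ∞ (fun y => covDeriv S g T y I) (S ∩ U) :=
  (h.contDiffOn_pderiv (hT _) _).sub (ContDiffOn.sum fun _ _ => ContDiffOn.sum fun _ _ =>
    (h.contDiffOn_christoffel _ _ _).mul (hT _))

theorem contDiffOn_nablaCurvature (h : IsMetricOn S U g) (j : ℕ) (I : Fin (j + 4) → Fin d) :
    ContDiffOn ℝ ∞ (fun y => nablaCurvature S g j y I) (S ∩ U) := by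
  induction j with
  | zero => exact h.contDiffOn_curvature I
  | succ j ih => exact h.contDiffOn_covDeriv ih I

theorem pderiv_symm (h : IsMetricOn S U g) (hx : x ∈ S ∩ U) (i j k : Fin d) :
    pderiv S (fun y => g y i j) k x = pderiv S (fun y => g y j i) k x :=
  pderiv_congr k h.isOpen (fun _ hy => h.symm hy i j) hx

theorem christoffel_symm (h : IsMetricOn S U g) (hx : x ∈ S ∩ U) (i j k : Fin d) :
    christoffel S g i j k x = christoffel S g i k j x := by
  simp only [christoffel]
  congr 1
  refine Finset.sum_congr rfl fun a _ => ?_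
  rw [h.pderiv_symm hx j k a]
  ring

theorem sum_mul_sum_inv (h : IsMetricOn S U g) (hx : x ∈ S ∩ U) (v : Fin d → ℝ) (b : Fin d) :
    ∑ i, g x b i * ∑ a, (g x)⁻¹ i a * v a = v b := by
  simp only [Finset.mul_sum, ← mul_assoc]
  rw [Finset.sum_comm]
  simp only [← Finset.sum_mul, h.mul_inv_apply hx]
  simp

/-- The Koszul formula for coordinate fields. -/
theorem lower_christoffel (h : IsMetricOn S U g) (hx : x ∈ S ∩ U) (b j k : Fin d) :
    ∑ i, g x b i * christoffel S g i j k x =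
      (1 / 2 : ℝ) * (pderiv S (fun y => g y b k) j x + pderiv S (fun y => g y b j) k x
        - pderiv S (fun y => g y j k) b x) := by
  simp only [christoffel, mul_left_comm (g x b _) (1 / 2 : ℝ)]
  rw [← Finset.mul_sum, h.sum_mul_sum_inv hx]

/-- Metric compatibility, `∇g = 0`: in the sum of two Koszul formulas all terms but one cancel. -/
theorem pderiv_metric (h : IsMetricOn S U g) (hx : x ∈ S ∩ U) (a b c : Fin d) :
    pderiv S (fun y => g y a b) c x =
      ∑ e, christoffel S g e c a x * g x e b + ∑ e, g x a e * christoffel S g e c b x := by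
  have h1 : ∑ e, christoffel S g e c a x * g x e b = ∑ e, g x b e * christoffel S g e c a x :=
    Finset.sum_congr rfl fun e _ => by rw [h.symm hx e b, mul_comm]
  rw [h1, h.lower_christoffel hx, h.lower_christoffel hx, h.pderiv_symm hx b a,
    h.pderiv_symm hx c a, h.pderiv_symm hx c b]
  ring

/-- This is `∇g⁻¹ = 0`. It follows from `∇g = 0` by differentiating `g g⁻¹ = 1` and multiplying by
`g⁻¹` from the left. -/
theorem pderiv_inv (h : IsMetricOn S U g) (hx : x ∈ S ∩ U) (a b c : Fin d) :
    pderiv S (fun y => (g y)⁻¹ a b) c x =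
      -∑ e, (g x)⁻¹ a e * christoffel S g b c e x - ∑ e, christoffel S g a c e x * (g x)⁻¹ e b := by
  let G := g x
  let Γ : Matrix (Fin d) (Fin d) ℝ := Matrix.of fun e a => christoffel S g e c a x
  let dG : Matrix (Fin d) (Fin d) ℝ := Matrix.of fun a b => pderiv S (fun y => g y a b) c x
  let dGi : Matrix (Fin d) (Fin d) ℝ := Matrix.of fun a b => pderiv S (fun y => (g y)⁻¹ a b) c x
  have hdG : dG = Γ.transpose * G + G * Γ := by
    ext a b
    simp [dG, Γ, G, Matrix.mul_apply, h.pderiv_metric hx]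
  have hu := h.uniqueDiffWithinAt hx
  have hzero : dG * G⁻¹ + G * dGi = 0 := by
    ext a b
    have key : pderiv S (fun y => ∑ i, g y a i * (g y)⁻¹ i b) c x = 0 := by
      rw [pderiv_congr c h.isOpen (f' := fun _ => if a = b then 1 else 0)
        (fun y hy => h.mul_inv_apply hy a b) hx, pderiv_const]
    rw [pderiv_sum_mul c _ hu (fun i _ => h.differentiableWithinAt (h.contDiffOn a i) hx)
      fun i _ => h.differentiableWithinAt (h.contDiffOn_inv i b) hx] at key
    simpa [Matrix.mul_apply, dG, dGi, G] using key
  have hGi : G⁻¹ * G = 1 := Matrix.nonsing_inv_mul _ (h.isUnit_det hx)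
  have hG : G * G⁻¹ = 1 := Matrix.mul_nonsing_inv _ (h.isUnit_det hx)
  have hmain : dGi = -(G⁻¹ * Γ.transpose) - Γ * G⁻¹ := by
    have h1 : G⁻¹ * (dG * G⁻¹ + G * dGi) = 0 := by rw [hzero, mul_zero]
    have h2 : G⁻¹ * (dG * G⁻¹ + G * dGi) =
        G⁻¹ * Γ.transpose * (G * G⁻¹) + (G⁻¹ * G) * (Γ * G⁻¹) + (G⁻¹ * G) * dGi := by
      rw [hdG]; noncomm_ring
    rw [h2, hG, hGi, one_mul, one_mul, mul_one] at h1
    rw [← sub_eq_zero, ← h1]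
    abel
  simpa [Matrix.mul_apply, dGi, Γ, G] using congrFun (congrFun hmain a) b

end IsMetricOn

/-! ### The geometry of the boundary -/

/-- The inclusion of the boundary as a continuous linear map. -/
noncomputable def bdryInclL (n : ℕ) : Coord n →L[ℝ] Coord (n + 1) :=
  LinearMap.toContinuousLinearMap
    { toFun := bdryIncl
      map_add' := fun x y => by
        ext i
        refine Fin.cases ?_ (fun a => ?_) i <;> simp [bdryIncl]
      map_smul' := fun c x => by
        ext i
        refine Fin.cases ?_ (fun a => ?_) i <;> simp [bdryIncl] }

theorem bdryInclL_apply {n : ℕ} (z : Coord n) : bdryInclL n z = bdryIncl z := rfl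

theorem bdryInclL_single {n : ℕ} (c : Fin n) :
    bdryInclL n (EuclideanSpace.single c 1) = EuclideanSpace.single c.succ 1 := by
  ext i
  rw [bdryInclL_apply]
  refine Fin.cases ?_ (fun a => ?_) i
  · simp [bdryIncl]
  · by_cases h : a = c <;> simp [bdryIncl, h]

theorem bdryIncl_mem_halfSpace {n : ℕ} (z : Coord n) : bdryIncl z ∈ halfSpace n := by
  simp [halfSpace, bdryIncl]

/-- The components in `ℝⁿ⁺¹` of a vector tangent to the boundary. -/
def pushTangent {n : ℕ} (v : Fin n → ℝ) : Fin (n + 1) → ℝ := Fin.cons 0 v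

theorem sum_mul_pushTangent {n : ℕ} (X : Fin (n + 1) → ℝ) (v : Fin n → ℝ) :
    ∑ i, X i * pushTangent v i = ∑ e, X e.succ * v e := by
  simp [Fin.sum_univ_succ, pushTangent]

theorem sum_pushTangent_mul {n : ℕ} (X : Fin (n + 1) → ℝ) (v : Fin n → ℝ) :
    ∑ i, pushTangent v i * X i = ∑ e, v e * X e.succ := by
  simp [Fin.sum_univ_succ, pushTangent]

/-- The components `l_{ab}` of the second fundamental form. -/
noncomputable abbrev secondFFComp {n : ℕ}
    (g : Coord (n + 1) → Matrix (Fin (n + 1)) (Fin (n + 1)) ℝ) (z : Coord n) (a b : Fin n) : ℝ :=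
  secondFF g z ![a, b]

theorem secondFF_eq_comp {n : ℕ} (g : Coord (n + 1) → Matrix (Fin (n + 1)) (Fin (n + 1)) ℝ)
    (z : Coord n) (I : Fin 2 → Fin n) : secondFF g z I = secondFFComp g z (I 0) (I 1) := by
  simp [secondFF]

namespace IsMetricOn

variable {n : ℕ} {U : Set (Coord (n + 1))}
  {g : Coord (n + 1) → Matrix (Fin (n + 1)) (Fin (n + 1)) ℝ} {z : Coord n}

theorem mem_of_bdryIncl_mem (hz : bdryIncl z ∈ U) : bdryIncl z ∈ halfSpace n ∩ U :=
  ⟨bdryIncl_mem_halfSpace z, hz⟩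

theorem contDiffOn_comp_bdryIncl {f : Coord (n + 1) → ℝ}
    (hf : ContDiffOn ℝ ∞ f (halfSpace n ∩ U)) :
    ContDiffOn ℝ ∞ (fun y => f (bdryIncl y)) (Set.univ ∩ bdryIncl ⁻¹' U) :=
  hf.comp (bdryInclL n).contDiff.contDiffOn fun y hy => ⟨bdryIncl_mem_halfSpace y, hy.2⟩

theorem bdry (h : IsMetricOn (halfSpace n) U g) :
    IsMetricOn Set.univ (bdryIncl ⁻¹' U) (bdryMetric g) where
  uniqueDiffOn := uniqueDiffOn_univ
  isOpen := h.isOpen.preimage (bdryInclL n).continuous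
  contDiffOn a b := contDiffOn_comp_bdryIncl (h.contDiffOn a.succ b.succ)
  posDef y hy := (h.posDef (bdryIncl y) ⟨bdryIncl_mem_halfSpace y, hy.2⟩).submatrix
    (Fin.succ_injective n)

theorem mem_bdry (hz : bdryIncl z ∈ U) : z ∈ Set.univ ∩ bdryIncl ⁻¹' U := ⟨trivial, hz⟩

/-- The chain rule. It applies to the one-sided derivative because the inclusion maps into the
half-space, and its differential sends `∂_c` to `∂_{c.succ}`. -/
theorem pderiv_comp_bdryIncl (h : IsMetricOn (halfSpace n) U g) (hz : bdryIncl z ∈ U)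
    {f : Coord (n + 1) → ℝ} (hf : ContDiffOn ℝ ∞ f (halfSpace n ∩ U)) (c : Fin n) :
    pderiv Set.univ (fun y => f (bdryIncl y)) c z = pderiv (halfSpace n) f c.succ (bdryIncl z) := by
  have h1 := (h.differentiableWithinAt hf (mem_of_bdryIncl_mem hz)).hasFDerivWithinAt
  have h2 := (h1.comp (s := Set.univ) z (bdryInclL n).hasFDerivAt.hasFDerivWithinAt
    fun y _ => bdryIncl_mem_halfSpace y).fderivWithin uniqueDiffWithinAt_univ
  change fderivWithin ℝ (f ∘ bdryInclL n) Set.univ z _ = _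
  erw [h2]
  rw [ContinuousLinearMap.comp_apply, bdryInclL_single]
  rfl

/-! ### The unit normal and the Gauss formula -/

section Normal

variable (h : IsMetricOn (halfSpace n) U g) (hz : bdryIncl z ∈ U)
include h hz

theorem inv_zero_zero_pos : 0 < (g (bdryIncl z))⁻¹ 0 0 :=
  (h.posDef _ (mem_of_bdryIncl_mem hz)).inv.diag_pos

theorem normal_zero_pos : 0 < normal g z 0 :=
  div_pos (h.inv_zero_zero_pos hz) (Real.sqrt_pos.2 (h.inv_zero_zero_pos hz))

/-- Up to the factor `√g^{00}`, `ν` is the gradient of `y₀`, so lowering its index gives a multiple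
of `dy₀`. -/
theorem metric_normal (j : Fin (n + 1)) :
    ∑ i, g (bdryIncl z) j i * normal g z i =
      (if j = 0 then 1 else 0) / Real.sqrt ((g (bdryIncl z))⁻¹ 0 0) := by
  rw [← h.mul_inv_apply (mem_of_bdryIncl_mem hz) j 0, Finset.sum_div]
  refine Finset.sum_congr rfl fun i _ => ?_
  rw [normal, h.inv_symm (mem_of_bdryIncl_mem hz) 0 i, mul_div_assoc]

theorem metric_tangent_normal (a : Fin n) : ∑ i, g (bdryIncl z) a.succ i * normal g z i = 0 := by
  simp [h.metric_normal hz]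

theorem metric_normal_normal :
    ∑ j, normal g z j * ∑ i, g (bdryIncl z) j i * normal g z i = 1 := by
  have hpos := h.inv_zero_zero_pos hz
  simp only [h.metric_normal hz]
  rw [Finset.sum_eq_single 0 (by intro b _ hb; simp [hb]) (by simp)]
  simp only [normal, if_true]
  rw [div_mul_div_comm, Real.mul_self_sqrt hpos.le, mul_one, div_self hpos.ne']

/-- The tangent vectors `∂_{a.succ}` and `ν` span, because `ν⁰ > 0`. Vector identities along the
boundary are proved by testing against them. -/
theorem eq_zero_of_orthogonal (v : Fin (n + 1) → ℝ)
    (ht : ∀ a : Fin n, ∑ i, g (bdryIncl z) a.succ i * v i = 0)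
    (hν : ∑ j, normal g z j * ∑ i, g (bdryIncl z) j i * v i = 0) : v = 0 := by
  rw [Fin.sum_univ_succ] at hν
  simp only [ht, mul_zero, Finset.sum_const_zero, add_zero, mul_eq_zero,
    (h.normal_zero_pos hz).ne', false_or] at hν
  refine Matrix.eq_zero_of_mulVec_eq_zero (h.det_ne_zero (mem_of_bdryIncl_mem hz)) ?_
  funext j
  exact Fin.cases hν ht j

omit hz in
theorem contDiffOn_normal (i : Fin (n + 1)) :
    ContDiffOn ℝ ∞ (fun y => normal g y i) (Set.univ ∩ bdryIncl ⁻¹' U) := by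
  have hpos : ∀ y ∈ Set.univ ∩ bdryIncl ⁻¹' U, 0 < (g (bdryIncl y))⁻¹ 0 0 :=
    fun y hy => h.inv_zero_zero_pos hy.2
  exact (contDiffOn_comp_bdryIncl (h.contDiffOn_inv 0 i)).div
    ((contDiffOn_comp_bdryIncl (h.contDiffOn_inv 0 0)).sqrt fun y hy => (hpos y hy).ne')
    fun y hy => (Real.sqrt_pos.2 (hpos y hy)).ne'

omit hz in
theorem contDiffOn_secondFF (I : Fin 2 → Fin n) :
    ContDiffOn ℝ ∞ (fun y => secondFF g y I) (Set.univ ∩ bdryIncl ⁻¹' U) :=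
  ContDiffOn.sum fun i _ => ContDiffOn.sum fun j _ =>
    ((contDiffOn_comp_bdryIncl (h.contDiffOn_christoffel _ _ _)).mul
      (contDiffOn_comp_bdryIncl (h.contDiffOn i j))).mul (h.contDiffOn_normal j)

omit hz in
theorem contDiffOn_nablaSecondFF (j : ℕ) (I : Fin (j + 2) → Fin n) :
    ContDiffOn ℝ ∞ (fun y => nablaSecondFF g j y I) (Set.univ ∩ bdryIncl ⁻¹' U) := by
  induction j with
  | zero => exact h.contDiffOn_secondFF I
  | succ j ih => exact h.bdry.contDiffOn_covDeriv ih I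

theorem secondFFComp_symm (a b : Fin n) : secondFFComp g z a b = secondFFComp g z b a := by
  simp only [secondFFComp, secondFF]
  refine Finset.sum_congr rfl fun i _ => Finset.sum_congr rfl fun j _ => ?_
  rw [h.christoffel_symm (mem_of_bdryIncl_mem hz)]
  rfl

/-- Both sides equal the same Koszul expression, which involves only tangential derivatives of
tangential components of `g`. So the tangential part of the ambient connection is the connection of
the boundary. -/
theorem lower_christoffel_tangent (a b c : Fin n) :
    ∑ i, g (bdryIncl z) a.succ i * christoffel (halfSpace n) g i b.succ c.succ (bdryIncl z) =
      ∑ e, bdryMetric g z a e * christoffel Set.univ (bdryMetric g) e b c z := by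
  rw [h.lower_christoffel (mem_of_bdryIncl_mem hz), h.bdry.lower_christoffel (mem_bdry hz)]
  simp only [← h.pderiv_comp_bdryIncl hz (h.contDiffOn _ _)]
  rfl

/-- The Gauss formula. -/
theorem christoffel_tangent (i : Fin (n + 1)) (c a : Fin n) :
    christoffel (halfSpace n) g i c.succ a.succ (bdryIncl z) =
      pushTangent (fun e => christoffel Set.univ (bdryMetric g) e c a z) i
        + secondFFComp g z c a * normal g z i := by
  have hmem := mem_of_bdryIncl_mem hz
  -- The difference of the two sides is tested against the tangent vectors, then against `ν`; the
  -- latter test recovers the definition of `l`.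
  have key := h.eq_zero_of_orthogonal hz
    (fun i => christoffel (halfSpace n) g i c.succ a.succ (bdryIncl z)
      - pushTangent (fun e => christoffel Set.univ (bdryMetric g) e c a z) i
      - secondFFComp g z c a * normal g z i) ?_ ?_
  · linarith [congrFun key i, Pi.zero_apply (M := fun _ : Fin (n + 1) => ℝ) i]
  · intro b
    simp only [mul_sub, Finset.sum_sub_distrib, mul_left_comm _ (secondFFComp g z c a)]
    rw [← Finset.mul_sum, h.metric_tangent_normal hz, sum_mul_pushTangent,
      h.lower_christoffel_tangent hz]
    simp [bdryMetric]
  · have h1 : ∑ j, normal g z j * ∑ i, g (bdryIncl z) j i *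
        pushTangent (fun e => christoffel Set.univ (bdryMetric g) e c a z) i = 0 := by
      simp only [sum_mul_pushTangent, Finset.mul_sum]
      rw [Finset.sum_comm]
      refine Finset.sum_eq_zero fun e _ => ?_
      rw [← mul_zero (christoffel Set.univ (bdryMetric g) e c a z),
        ← h.metric_tangent_normal hz e, Finset.mul_sum]
      refine Finset.sum_congr rfl fun j _ => ?_
      rw [h.symm hmem j e.succ]
      ring
    have h2 : ∑ j, normal g z j * ∑ i, g (bdryIncl z) j i *
        christoffel (halfSpace n) g i c.succ a.succ (bdryIncl z) = secondFFComp g z c a := by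
      simp only [secondFFComp, secondFF, Finset.mul_sum]
      rw [Finset.sum_comm]
      refine Finset.sum_congr rfl fun i _ => Finset.sum_congr rfl fun j _ => ?_
      rw [h.symm hmem i j]
      simp
      ring
    simp only [mul_sub, Finset.sum_sub_distrib, mul_left_comm _ (secondFFComp g z c a),
      ← Finset.mul_sum]
    rw [h1, h2, h.metric_normal_normal hz]
    ring

theorem sum_christoffel_tangent_mul (X : Fin (n + 1) → ℝ) (c a : Fin n) :
    ∑ i, christoffel (halfSpace n) g i c.succ a.succ (bdryIncl z) * X i =
      ∑ e, christoffel Set.univ (bdryMetric g) e c a z * X e.succ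
        + secondFFComp g z c a * ∑ i, normal g z i * X i := by
  simp only [h.christoffel_tangent hz, add_mul, Finset.sum_add_distrib, sum_pushTangent_mul,
    mul_assoc, Finset.mul_sum]

end Normal

end IsMetricOn

/-! ### The Weingarten formula, the Gauss equation and raised indices -/

namespace IsMetricOn

theorem sum_mul_sharp {d r : ℕ} {S U : Set (Coord d)} {g : Coord d → Matrix (Fin d) (Fin d) ℝ}
    {x : Coord d} (h : IsMetricOn S U g) (hx : x ∈ S ∩ U) (T : (Fin (r + 1) → Fin d) → ℝ)
    (b : Fin d) (J : Fin r → Fin d) : ∑ i, g x b i * sharp (g x) T i J = T (Fin.cons b J) :=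
  h.sum_mul_sum_inv hx (fun c => T (Fin.cons c J)) b

section

variable {n : ℕ} {U : Set (Coord (n + 1))}
  {g : Coord (n + 1) → Matrix (Fin (n + 1)) (Fin (n + 1)) ℝ} {z : Coord n}
  (h : IsMetricOn (halfSpace n) U g) (hz : bdryIncl z ∈ U)
include h hz

theorem differentiableWithinAt_normal (i : Fin (n + 1)) :
    DifferentiableWithinAt ℝ (fun y => normal g y i) Set.univ z :=
  h.bdry.differentiableWithinAt (h.contDiffOn_normal i) (mem_bdry hz)

theorem differentiableWithinAt_comp_bdryIncl {f : Coord (n + 1) → ℝ}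
    (hf : ContDiffOn ℝ ∞ f (halfSpace n ∩ U)) :
    DifferentiableWithinAt ℝ (fun y => f (bdryIncl y)) Set.univ z :=
  h.bdry.differentiableWithinAt (contDiffOn_comp_bdryIncl hf) (mem_bdry hz)

theorem differentiableWithinAt_metric (i j : Fin (n + 1)) :
    DifferentiableWithinAt ℝ (fun y => g (bdryIncl y) i j) Set.univ z :=
  h.differentiableWithinAt_comp_bdryIncl hz (h.contDiffOn i j)

theorem pderiv_metric_bdryIncl (a b : Fin (n + 1)) (c : Fin n) :
    pderiv Set.univ (fun y => g (bdryIncl y) a b) c z =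
      ∑ e, christoffel (halfSpace n) g e c.succ a (bdryIncl z) * g (bdryIncl z) e b
        + ∑ e, g (bdryIncl z) a e * christoffel (halfSpace n) g e c.succ b (bdryIncl z) := by
  rw [h.pderiv_comp_bdryIncl hz (h.contDiffOn a b), h.pderiv_metric (mem_of_bdryIncl_mem hz)]

/-- Differentiating `g(∂ₐ, ν) = 0` gives `g(∂ₐ, ∇_c ν) = -g(∇_c ∂ₐ, ν)`. -/
theorem metric_tangent_nablaNormal (a c : Fin n) :
    ∑ i, g (bdryIncl z) a.succ i * (pderiv Set.univ (fun y => normal g y i) c z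
      + ∑ j, christoffel (halfSpace n) g i c.succ j (bdryIncl z) * normal g z j) =
      -secondFFComp g z c a := by
  have key : pderiv Set.univ (fun y => ∑ i, g (bdryIncl y) a.succ i * normal g y i) c z = 0 := by
    rw [pderiv_congr c h.bdry.isOpen (f' := fun _ => 0)
      (fun y hy => h.metric_tangent_normal hy.2 a) (mem_bdry hz), pderiv_const]
  rw [pderiv_sum_mul c _ uniqueDiffWithinAt_univ
    (fun i _ => h.differentiableWithinAt_metric hz a.succ i)
    (fun i _ => h.differentiableWithinAt_normal hz i)] at key
  simp only [h.pderiv_metric_bdryIncl hz, add_mul, Finset.sum_add_distrib] at key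
  have h1 : ∑ i, (∑ e, christoffel (halfSpace n) g e c.succ a.succ (bdryIncl z)
      * g (bdryIncl z) e i) * normal g z i = secondFFComp g z c a := by
    simp only [secondFFComp, secondFF, Finset.sum_mul]
    rw [Finset.sum_comm]
    simp
  have h2 : ∑ i, (∑ e, g (bdryIncl z) a.succ e *
      christoffel (halfSpace n) g e c.succ i (bdryIncl z)) * normal g z i =
      ∑ i, g (bdryIncl z) a.succ i *
        ∑ j, christoffel (halfSpace n) g i c.succ j (bdryIncl z) * normal g z j := by
    simp only [Finset.sum_mul, Finset.mul_sum, mul_assoc]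
    rw [Finset.sum_comm]
  rw [h1, h2] at key
  simp only [mul_add, Finset.sum_add_distrib]
  linarith

/-- Differentiating `g(ν, ν) = 1` gives `2 g(ν, ∇_c ν) = 0`. -/
theorem metric_normal_nablaNormal (c : Fin n) :
    ∑ j, normal g z j * ∑ i, g (bdryIncl z) j i * (pderiv Set.univ (fun y => normal g y i) c z
      + ∑ j, christoffel (halfSpace n) g i c.succ j (bdryIncl z) * normal g z j) = 0 := by
  have hu : UniqueDiffWithinAt ℝ (Set.univ : Set (Coord n)) z := uniqueDiffWithinAt_univ
  have key : pderiv Set.univ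
      (fun y => ∑ j, normal g y j * ∑ i, g (bdryIncl y) j i * normal g y i) c z = 0 := by
    rw [pderiv_congr c h.bdry.isOpen (f' := fun _ => 1)
      (fun y hy => h.metric_normal_normal hy.2) (mem_bdry hz), pderiv_const]
  rw [pderiv_sum_mul c _ hu (fun j _ => h.differentiableWithinAt_normal hz j)
    (fun j _ => DifferentiableWithinAt.fun_sum fun i _ =>
      (h.differentiableWithinAt_metric hz j i).fun_mul
        (h.differentiableWithinAt_normal hz i))] at key
  simp only [pderiv_sum_mul c _ hu (fun i _ => h.differentiableWithinAt_metric hz _ i)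
    (fun i _ => h.differentiableWithinAt_normal hz i)] at key
  let G := g (bdryIncl z)
  let Γ : Matrix (Fin (n + 1)) (Fin (n + 1)) ℝ :=
    Matrix.of fun e a => christoffel (halfSpace n) g e c.succ a (bdryIncl z)
  let dG : Matrix (Fin (n + 1)) (Fin (n + 1)) ℝ :=
    Matrix.of fun a b => pderiv Set.univ (fun y => g (bdryIncl y) a b) c z
  let ν : Fin (n + 1) → ℝ := normal g z
  let dν : Fin (n + 1) → ℝ := fun i => pderiv Set.univ (fun y => normal g y i) c z
  have hdG : dG = Γ.transpose * G + G * Γ := by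
    ext a b
    simp [dG, Γ, G, Matrix.mul_apply, h.pderiv_metric_bdryIncl hz]
  have hG : G.transpose = G := by
    ext i j
    exact h.symm (mem_of_bdryIncl_mem hz) j i
  have hswap : ∀ v w : Fin (n + 1) → ℝ, v ⬝ᵥ G.mulVec w = w ⬝ᵥ G.mulVec v := fun v w => by
    rw [Matrix.dotProduct_mulVec, ← Matrix.mulVec_transpose, hG, dotProduct_comm]
  -- With `dG = ΓᵀG + GΓ` and the symmetry of `G`, the left side becomes twice the wanted
  -- expression.
  have key' : dν ⬝ᵥ G.mulVec ν + ν ⬝ᵥ (dG.mulVec ν + G.mulVec dν) = 0 := key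
  have h3 : ν ⬝ᵥ Γ.transpose.mulVec (G.mulVec ν) = ν ⬝ᵥ G.mulVec (Γ.mulVec ν) := by
    rw [Matrix.dotProduct_mulVec, ← Matrix.mulVec_transpose, Matrix.transpose_transpose, hswap]
  rw [hdG, Matrix.add_mulVec, ← Matrix.mulVec_mulVec, ← Matrix.mulVec_mulVec, dotProduct_add,
    dotProduct_add, h3, hswap dν ν] at key'
  change ν ⬝ᵥ G.mulVec (dν + Γ.mulVec ν) = 0
  rw [Matrix.mulVec_add, dotProduct_add]
  linarith

/-- The Weingarten formula. -/
theorem nablaNormal_eq (i : Fin (n + 1)) (c : Fin n) :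
    pderiv Set.univ (fun y => normal g y i) c z
      + ∑ j, christoffel (halfSpace n) g i c.succ j (bdryIncl z) * normal g z j =
      -pushTangent (fun e => sharp (bdryMetric g z) (secondFF g z) e (fun _ : Fin 1 => c)) i := by
  have hmem := mem_of_bdryIncl_mem hz
  have hsharp : ∀ a, ∑ e, g (bdryIncl z) a.succ e.succ *
      sharp (bdryMetric g z) (secondFF g z) e (fun _ : Fin 1 => c) = secondFFComp g z a c :=
    fun a => by
      refine (h.bdry.sum_mul_sharp (mem_bdry hz) (secondFF g z) a fun _ : Fin 1 => c).trans ?_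
      rw [secondFF_eq_comp]
      rfl
  have key := h.eq_zero_of_orthogonal hz
    (fun i => (pderiv Set.univ (fun y => normal g y i) c z
      + ∑ j, christoffel (halfSpace n) g i c.succ j (bdryIncl z) * normal g z j)
      + pushTangent (fun e => sharp (bdryMetric g z) (secondFF g z) e (fun _ : Fin 1 => c)) i) ?_ ?_
  · exact eq_neg_of_add_eq_zero_left (congrFun key i)
  · intro a
    simp only [mul_add (g _ _ _) (_ + _) (pushTangent _ _), Finset.sum_add_distrib (f := fun i =>
      g (bdryIncl z) a.succ i * (pderiv Set.univ (fun y => normal g y i) c z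
      + ∑ j, christoffel (halfSpace n) g i c.succ j (bdryIncl z) * normal g z j))]
    rw [h.metric_tangent_nablaNormal hz, sum_mul_pushTangent, hsharp, h.secondFFComp_symm hz]
    ring
  · simp only [mul_add (g _ _ _) (_ + _) (pushTangent _ _), Finset.sum_add_distrib (f := fun i =>
      g (bdryIncl z) _ i * (pderiv Set.univ (fun y => normal g y i) c z
      + ∑ j, christoffel (halfSpace n) g i c.succ j (bdryIncl z) * normal g z j))]
    simp only [mul_add (normal g z _) (∑ _, _ * _) _, Finset.sum_add_distrib (f := fun j =>
      normal g z j * ∑ i, g (bdryIncl z) j i * (pderiv Set.univ (fun y => normal g y i) c z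
      + ∑ j, christoffel (halfSpace n) g i c.succ j (bdryIncl z) * normal g z j))]
    rw [h.metric_normal_nablaNormal hz, zero_add]
    simp only [sum_mul_pushTangent, Finset.mul_sum]
    rw [Finset.sum_comm]
    refine Finset.sum_eq_zero fun e _ => ?_
    rw [← zero_mul (sharp (bdryMetric g z) (secondFF g z) e fun _ : Fin 1 => c),
      ← h.metric_tangent_normal hz e, Finset.sum_mul]
    refine Finset.sum_congr rfl fun j _ => ?_
    rw [h.symm hmem j e.succ]
    ring

/-- The left side is the component `i` of `∇_c ∇_d ∂ₐ`. The Gauss formula for `∇_d ∂ₐ` is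
differentiated along the boundary, and the Weingarten formula turns the derivative of `ν` into the
tangential term with `l^{*₁}`. -/
theorem pderiv_christoffel_tangent (i : Fin (n + 1)) (c d a : Fin n) :
    pderiv (halfSpace n) (christoffel (halfSpace n) g i d.succ a.succ) c.succ (bdryIncl z)
      + ∑ j, christoffel (halfSpace n) g i c.succ j (bdryIncl z)
        * christoffel (halfSpace n) g j d.succ a.succ (bdryIncl z) =
    pushTangent (fun e => pderiv Set.univ (christoffel Set.univ (bdryMetric g) e d a) c z
      + ∑ f, christoffel Set.univ (bdryMetric g) e c f z
        * christoffel Set.univ (bdryMetric g) f d a z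
      - secondFFComp g z d a *
        sharp (bdryMetric g z) (secondFF g z) e (fun _ : Fin 1 => c)) i
    + (pderiv Set.univ (fun y => secondFFComp g y d a) c z
      + ∑ f, secondFFComp g z c f * christoffel Set.univ (bdryMetric g) f d a z)
      * normal g z i := by
  have hu : UniqueDiffWithinAt ℝ (Set.univ : Set (Coord n)) z := uniqueDiffWithinAt_univ
  have hL : DifferentiableWithinAt ℝ (fun y => secondFFComp g y d a) Set.univ z :=
    h.bdry.differentiableWithinAt (h.contDiffOn_secondFF _) (mem_bdry hz)
  have hN := h.differentiableWithinAt_normal hz i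
  have hpush : DifferentiableWithinAt ℝ (fun y => pushTangent (fun e =>
      christoffel Set.univ (bdryMetric g) e d a y) i) Set.univ z := by
    refine Fin.cases ?_ (fun e => ?_) i
    · exact differentiableWithinAt_const (c := (0 : ℝ))
    · exact h.bdry.differentiableWithinAt (h.bdry.contDiffOn_christoffel e d a) (mem_bdry hz)
  have hdpush : pderiv Set.univ (fun y => pushTangent (fun e =>
      christoffel Set.univ (bdryMetric g) e d a y) i) c z = pushTangent (fun e =>
        pderiv Set.univ (christoffel Set.univ (bdryMetric g) e d a) c z) i := by
    refine Fin.cases ?_ (fun e => rfl) i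
    exact pderiv_const c 0
  have h1 : pderiv (halfSpace n) (christoffel (halfSpace n) g i d.succ a.succ) c.succ
      (bdryIncl z) = pushTangent (fun e =>
        pderiv Set.univ (christoffel Set.univ (bdryMetric g) e d a) c z) i
      + (pderiv Set.univ (fun y => secondFFComp g y d a) c z * normal g z i
        + secondFFComp g z d a * pderiv Set.univ (fun y => normal g y i) c z) := by
    rw [← h.pderiv_comp_bdryIncl hz (h.contDiffOn_christoffel _ _ _),
      pderiv_congr c h.bdry.isOpen (fun y hy => h.christoffel_tangent hy.2 i d a) (mem_bdry hz),
      pderiv_add c hu hpush (hL.fun_mul hN), pderiv_mul c hu hL hN, hdpush]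
  have h2 : ∑ j, christoffel (halfSpace n) g i c.succ j (bdryIncl z)
        * christoffel (halfSpace n) g j d.succ a.succ (bdryIncl z) =
      ∑ f, (pushTangent (fun e => christoffel Set.univ (bdryMetric g) e c f z) i
        + secondFFComp g z c f * normal g z i) * christoffel Set.univ (bdryMetric g) f d a z
      + secondFFComp g z d a *
        ∑ j, christoffel (halfSpace n) g i c.succ j (bdryIncl z) * normal g z j := by
    simp only [h.christoffel_tangent hz _ d a, mul_add, Finset.sum_add_distrib,
      sum_mul_pushTangent, h.christoffel_tangent hz i c, Finset.mul_sum, add_mul]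
    congr 1
    exact Finset.sum_congr rfl fun j _ => by ring
  have h3 := h.nablaNormal_eq hz i c
  have h4 : pderiv Set.univ (fun y => normal g y i) c z = -pushTangent (fun e =>
      sharp (bdryMetric g z) (secondFF g z) e (fun _ : Fin 1 => c)) i
      - ∑ j, christoffel (halfSpace n) g i c.succ j (bdryIncl z) * normal g z j := by linarith
  rw [h1, h2, h4]
  simp only [add_mul, Finset.sum_add_distrib, Finset.sum_mul]
  have h5 : ∑ f, secondFFComp g z c f * normal g z i *
      christoffel Set.univ (bdryMetric g) f d a z =
      ∑ f, secondFFComp g z c f * christoffel Set.univ (bdryMetric g) f d a z * normal g z i :=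
    Finset.sum_congr rfl fun f _ => by ring
  rw [h5]
  refine Fin.cases ?_ (fun e => ?_) i
  · simp [pushTangent]; ring
  · simp [pushTangent]; ring

/-- The Gauss equation. -/
theorem curvature_bdryMetric (I : Fin 4 → Fin n) :
    curvature Set.univ (bdryMetric g) z I =
      curvature (halfSpace n) g (bdryIncl z) (fun s => (I s).succ)
        + secondFFComp g z (I 0) (I 2) * secondFFComp g z (I 1) (I 3)
        - secondFFComp g z (I 0) (I 3) * secondFFComp g z (I 1) (I 2) := by
  have hsharp : ∀ b c, ∑ e, g (bdryIncl z) (Fin.succ b) e.succ *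
      sharp (bdryMetric g z) (secondFF g z) e (fun _ : Fin 1 => c) = secondFFComp g z b c :=
    fun b c => by
      refine (h.bdry.sum_mul_sharp (mem_bdry hz) (secondFF g z) b fun _ : Fin 1 => c).trans ?_
      rw [secondFF_eq_comp]
      rfl
  -- Pairing `∇_c ∇_d ∂ₐ` with a tangent vector removes the multiple of `ν` and leaves one product
  -- of two factors `l`. The curvature is the difference of two such pairings, with `c` and `d`
  -- exchanged.
  have half : ∀ a b c d : Fin n, ∑ i, g (bdryIncl z) b.succ i *
      (pderiv (halfSpace n) (christoffel (halfSpace n) g i d.succ a.succ) c.succ (bdryIncl z)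
        + ∑ j, christoffel (halfSpace n) g i c.succ j (bdryIncl z)
          * christoffel (halfSpace n) g j d.succ a.succ (bdryIncl z)) =
      ∑ e, bdryMetric g z b e *
        (pderiv Set.univ (christoffel Set.univ (bdryMetric g) e d a) c z
          + ∑ f, christoffel Set.univ (bdryMetric g) e c f z
            * christoffel Set.univ (bdryMetric g) f d a z)
      - secondFFComp g z d a * secondFFComp g z b c := fun a b c d => by
    simp only [h.pderiv_christoffel_tangent hz]
    simp only [mul_add (g _ _ _) (pushTangent _ _) _, Finset.sum_add_distrib (g := fun i =>
      g (bdryIncl z) b.succ i * (_ * normal g z i)), sum_mul_pushTangent]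
    have h0 : ∀ r : ℝ, ∑ i, g (bdryIncl z) b.succ i * (r * normal g z i) = 0 := fun r => by
      simp only [mul_left_comm _ r]
      rw [← Finset.mul_sum, h.metric_tangent_normal hz, mul_zero]
    rw [h0, add_zero, ← hsharp b c, Finset.mul_sum, ← Finset.sum_sub_distrib]
    refine Finset.sum_congr rfl fun e _ => ?_
    simp only [bdryMetric, Matrix.of_apply]
    ring
  have e1 := half (I 1) (I 0) (I 2) (I 3)
  have e2 := half (I 1) (I 0) (I 3) (I 2)
  have hsplit : ∀ {m : ℕ} (A B C : Fin m → ℝ) (P Q : Fin m → Fin m → ℝ),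
      ∑ i, A i * (B i - C i + ∑ j, (P i j - Q i j)) =
        ∑ i, A i * (B i + ∑ j, P i j) - ∑ i, A i * (C i + ∑ j, Q i j) := fun A B C P Q => by
    rw [← Finset.sum_sub_distrib]
    refine Finset.sum_congr rfl fun i _ => ?_
    rw [Finset.sum_sub_distrib]
    ring
  rw [curvature, curvature, hsplit, hsplit, e1, e2, h.secondFFComp_symm hz (I 3) (I 1),
    h.secondFFComp_symm hz (I 2) (I 1)]
  ring

/-- Raising the first entry commutes with covariant derivatives. -/
theorem pderiv_sharp {r : ℕ} {T : TField n (r + 1)}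
    (hT : ∀ I, ContDiffOn ℝ ∞ (fun y => T y I) (Set.univ ∩ bdryIncl ⁻¹' U))
    (i c : Fin n) (J : Fin r → Fin n) :
    pderiv Set.univ (fun y => sharp (bdryMetric g y) (T y) i J) c z
      + ∑ e, christoffel Set.univ (bdryMetric g) i c e z * sharp (bdryMetric g z) (T z) e J
      - ∑ s, ∑ e, christoffel Set.univ (bdryMetric g) e c (J s) z *
          sharp (bdryMetric g z) (T z) i (Function.update J s e) =
      sharp (bdryMetric g z) (covDeriv Set.univ (bdryMetric g) T z) i (Fin.snoc J c) := by
  have hb := h.bdry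
  have hm := mem_bdry (n := n) hz
  have h1 : pderiv Set.univ (fun y => sharp (bdryMetric g y) (T y) i J) c z =
      ∑ a, pderiv Set.univ (fun y => (bdryMetric g y)⁻¹ i a) c z * T z (Fin.cons a J)
        + ∑ a, (bdryMetric g z)⁻¹ i a * pderiv Set.univ (fun y => T y (Fin.cons a J)) c z :=
    pderiv_sum_mul c _ uniqueDiffWithinAt_univ
      (fun a _ => hb.differentiableWithinAt (hb.contDiffOn_inv i a) hm)
      fun a _ => hb.differentiableWithinAt (hT _) hm
  have h2 : ∀ a, covDeriv Set.univ (bdryMetric g) T z (Fin.cons a (Fin.snoc J c)) =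
      pderiv Set.univ (fun y => T y (Fin.cons a J)) c z
      - (∑ e, christoffel Set.univ (bdryMetric g) e c a z * T z (Fin.cons e J)
        + ∑ s, ∑ e, christoffel Set.univ (bdryMetric g) e c (J s) z *
          T z (Fin.cons a (Function.update J s e))) := fun a => by
    rw [Fin.cons_snoc_eq_snoc_cons]
    simp only [covDeriv, Fin.snoc_last, Fin.snoc_castSucc]
    rw [Fin.sum_univ_succ]
    simp [Fin.cons_update]
  -- Of the two Christoffel terms of `∂g⁻¹`, one cancels the correction for the upper index and the
  -- other becomes the correction for the first lower entry of `T`.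
  simp only [h1, hb.pderiv_inv hm]
  simp only [sharp, h2, mul_sub, mul_add, sub_mul, neg_mul, Finset.sum_sub_distrib,
    Finset.sum_add_distrib, Finset.sum_neg_distrib, Finset.mul_sum, Finset.sum_mul]
  have h3 : ∑ a, ∑ e, (bdryMetric g z)⁻¹ i e * christoffel Set.univ (bdryMetric g) a c e z
      * T z (Fin.cons a J) = ∑ a, ∑ e, (bdryMetric g z)⁻¹ i a *
        (christoffel Set.univ (bdryMetric g) e c a z * T z (Fin.cons e J)) := by
    rw [Finset.sum_comm]
    simp only [mul_assoc]
  have h4 : ∑ a, ∑ e, christoffel Set.univ (bdryMetric g) i c e z * (bdryMetric g z)⁻¹ e a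
      * T z (Fin.cons a J) = ∑ e, ∑ a, christoffel Set.univ (bdryMetric g) i c e z *
        ((bdryMetric g z)⁻¹ e a * T z (Fin.cons a J)) := by
    rw [Finset.sum_comm]
    simp only [mul_assoc]
  have h5 : ∑ s, ∑ e, ∑ a, christoffel Set.univ (bdryMetric g) e c (J s) z *
      ((bdryMetric g z)⁻¹ i a * T z (Fin.cons a (Function.update J s e))) =
      ∑ a, ∑ s, ∑ e, (bdryMetric g z)⁻¹ i a * (christoffel Set.univ (bdryMetric g) e c (J s) z *
        T z (Fin.cons a (Function.update J s e))) := by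
    rw [Finset.sum_congr rfl fun s _ => Finset.sum_comm, Finset.sum_comm]
    simp only [mul_left_comm _ ((bdryMetric g z)⁻¹ _ _)]
  rw [h3, h4, h5]
  ring

end

end IsMetricOn

/-! ### Covariant derivatives of tensors along the boundary with entries of both kinds -/

/-- The components of a covariant tensor at a boundary point, with `a` entries in `TM` and `b`
entries in `T∂M`. -/
abbrev MixedTensor (n a b : ℕ) : Type := (Fin a → Fin (n + 1)) → (Fin b → Fin n) → ℝ

/-- The covariant derivative in the direction `∂_c` of a tensor field along the boundary, with
respect to the Levi-Civita connections of the manifold and of its boundary. -/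
noncomputable def mixedDeriv {n a b : ℕ} (g : Coord (n + 1) → Matrix (Fin (n + 1)) (Fin (n + 1)) ℝ)
    (F : Coord n → MixedTensor n a b) (z : Coord n) (c : Fin n) : MixedTensor n a b := fun I J =>
  pderiv Set.univ (fun y => F y I J) c z
    - ∑ s, ∑ i, christoffel (halfSpace n) g i c.succ (I s) (bdryIncl z) *
        F z (Function.update I s i) J
    - ∑ s, ∑ e, christoffel Set.univ (bdryMetric g) e c (J s) z * F z I (Function.update J s e)

namespace MixedTensor

variable {n a b a' b' r : ℕ}

/-- The tensor product. -/
def prod (T : MixedTensor n a b) (T' : MixedTensor n a' b') :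
    MixedTensor n (a + a') (b + b') := fun I J =>
  T (fun i => I (Fin.castAdd a' i)) (fun i => J (Fin.castAdd b' i)) *
    T' (fun i => I (Fin.natAdd a i)) (fun i => J (Fin.natAdd b i))

/-- Permutation of the entries. -/
def permute (σ : Equiv.Perm (Fin a)) (τ : Equiv.Perm (Fin b)) (T : MixedTensor n a b) :
    MixedTensor n a b := fun I J => T (fun i => I (σ i)) (fun i => J (τ i))

/-- Restriction of the last entry in `TM` to `T∂M`. -/
def restrictLast (T : MixedTensor n (a + 1) b) : MixedTensor n a (b + 1) := fun I J =>
  T (Fin.snoc I (J (Fin.last b)).succ) (fun i => J i.castSucc)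

/-- Contraction of the last entry in `TM` with a vector. -/
def contractVector (ν : Fin (n + 1) → ℝ) (T : MixedTensor n (a + 1) b) : MixedTensor n a b :=
  fun I J => ∑ i, T (Fin.snoc I i) J * ν i

/-- Contraction of the last entry in `T∂M` with a vector-valued tensor. -/
def contractLast (A : Fin n → (Fin r → Fin n) → ℝ) (T : MixedTensor n a (b + 1)) :
    MixedTensor n a (b + r) := fun I J =>
  ∑ c, T I (Fin.snoc (fun i => J (Fin.castAdd r i)) c) * A c (fun i => J (Fin.natAdd b i))

end MixedTensor

open MixedTensor

/-! ### Replacing one index in concatenated multi-indices -/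

section Update

variable {α : Type*} {a b : ℕ} (I : Fin (a + b) → α) (i : α)

theorem castAdd_ne_natAdd (s : Fin a) (t : Fin b) : Fin.castAdd b s ≠ Fin.natAdd a t := by
  simp only [ne_eq, Fin.ext_iff, Fin.val_castAdd, Fin.val_natAdd]
  omega

theorem update_castAdd_castAdd (s : Fin a) :
    (fun t : Fin a => Function.update I (Fin.castAdd b s) i (Fin.castAdd b t)) =
      Function.update (fun t => I (Fin.castAdd b t)) s i :=
  Function.update_comp_eq_of_injective I (Fin.castAdd_injective a b) s i

theorem update_castAdd_natAdd (s : Fin a) :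
    (fun t : Fin b => Function.update I (Fin.castAdd b s) i (Fin.natAdd a t)) =
      fun t => I (Fin.natAdd a t) :=
  funext fun t => Function.update_of_ne (castAdd_ne_natAdd s t).symm _ _

theorem update_natAdd_castAdd (s : Fin b) :
    (fun t : Fin a => Function.update I (Fin.natAdd a s) i (Fin.castAdd b t)) =
      fun t => I (Fin.castAdd b t) :=
  funext fun t => Function.update_of_ne (castAdd_ne_natAdd t s) _ _

theorem update_natAdd_natAdd (s : Fin b) :
    (fun t : Fin b => Function.update I (Fin.natAdd a s) i (Fin.natAdd a t)) =
      Function.update (fun t => I (Fin.natAdd a t)) s i :=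
  Function.update_comp_eq_of_injective I (Fin.natAdd_injective b a) s i

theorem update_castSucc_castSucc (K : Fin (a + 1) → α) (s : Fin a) :
    (fun t : Fin a => Function.update K s.castSucc i t.castSucc) =
      Function.update (fun t => K t.castSucc) s i :=
  Function.update_comp_eq_of_injective K (Fin.castSucc_injective a) s i

theorem update_last_castSucc (K : Fin (a + 1) → α) :
    (fun t : Fin a => Function.update K (Fin.last a) i t.castSucc) = fun t => K t.castSucc :=
  funext fun t => Function.update_of_ne (Fin.castSucc_lt_last t).ne _ _

end Update

/-! ### Leibniz rules for the mixed covariant derivative -/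

namespace IsMetricOn

variable {n a b a' b' r : ℕ} {U : Set (Coord (n + 1))}
  {g : Coord (n + 1) → Matrix (Fin (n + 1)) (Fin (n + 1)) ℝ} {z : Coord n}
  (h : IsMetricOn (halfSpace n) U g) (hz : bdryIncl z ∈ U)

section

variable {F F' : Coord n → MixedTensor n a b}
  (hF : ∀ I J, ContDiffOn ℝ ∞ (fun y => F y I J) (Set.univ ∩ bdryIncl ⁻¹' U))

include h hz

theorem mixedDeriv_congr (hFF' : ∀ y, bdryIncl y ∈ U → F y = F' y) (c : Fin n) :
    mixedDeriv g F z c = mixedDeriv g F' z c := by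
  funext I J
  simp only [mixedDeriv]
  rw [pderiv_congr c h.bdry.isOpen (fun y hy => by rw [hFF' y hy.2]) (mem_bdry hz), hFF' z hz]

include hF

theorem mixedDeriv_add_smul (hF' : ∀ I J, ContDiffOn ℝ ∞ (fun y => F' y I J)
    (Set.univ ∩ bdryIncl ⁻¹' U)) (k : ℝ) (c : Fin n) :
    mixedDeriv g (fun y => k • F y + F' y) z c =
      k • mixedDeriv g F z c + mixedDeriv g F' z c := by
  funext I J
  have h1 := h.bdry.differentiableWithinAt (hF I J) (mem_bdry hz)
  have h2 := h.bdry.differentiableWithinAt (hF' I J) (mem_bdry hz)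
  simp only [mixedDeriv, Pi.add_apply, Pi.smul_apply, smul_eq_mul, mul_add,
    Finset.sum_add_distrib, mul_left_comm _ k, ← Finset.mul_sum]
  rw [pderiv_add c uniqueDiffWithinAt_univ ((differentiableWithinAt_const k).fun_mul h1) h2,
    pderiv_const_mul c uniqueDiffWithinAt_univ h1]
  ring

theorem mixedDeriv_prod {G : Coord n → MixedTensor n a' b'}
    (hG : ∀ I J, ContDiffOn ℝ ∞ (fun y => G y I J) (Set.univ ∩ bdryIncl ⁻¹' U)) (c : Fin n) :
    mixedDeriv g (fun y => (F y).prod (G y)) z c =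
      (mixedDeriv g F z c).prod (G z) + (F z).prod (mixedDeriv g G z c) := by
  funext I J
  have h1 := fun I J => h.bdry.differentiableWithinAt (hF I J) (mem_bdry hz)
  have h2 := fun I J => h.bdry.differentiableWithinAt (hG I J) (mem_bdry hz)
  simp only [mixedDeriv, MixedTensor.prod, Pi.add_apply]
  rw [pderiv_mul c uniqueDiffWithinAt_univ (h1 _ _) (h2 _ _)]
  simp only [Fin.sum_univ_add (a := a) (b := a'), Fin.sum_univ_add (a := b) (b := b'), update_castAdd_castAdd, update_castAdd_natAdd,
    update_natAdd_castAdd, update_natAdd_natAdd, sub_mul, mul_sub, Finset.sum_mul,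
    Finset.mul_sum, mul_assoc, mul_left_comm _ (F z _ _)]
  ring

omit h hz hF in
theorem mixedDeriv_permute (σ : Equiv.Perm (Fin a)) (τ : Equiv.Perm (Fin b)) (c : Fin n) :
    mixedDeriv g (fun y => (F y).permute σ τ) z c = (mixedDeriv g F z c).permute σ τ := by
  funext I J
  simp only [mixedDeriv, MixedTensor.permute]
  congr 1
  · congr 1
    rw [← Equiv.sum_comp σ]
    refine Finset.sum_congr rfl fun s _ => Finset.sum_congr rfl fun i _ => ?_
    congr 2
    exact Function.update_comp_eq_of_injective I σ.injective s i
  · rw [← Equiv.sum_comp τ]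
    refine Finset.sum_congr rfl fun s _ => Finset.sum_congr rfl fun i _ => ?_
    congr 1
    exact congrArg _ (Function.update_comp_eq_of_injective J τ.injective s i)

end

section

include h hz

/-- The restricted entry is corrected by the boundary connection before the equality sign and by the
ambient one after it; by the Gauss formula the two differ by `l` times `ν`. This is how `ν` enters
the expressions. -/
theorem mixedDeriv_restrictLast {F : Coord n → MixedTensor n (a + 1) b} (c : Fin n)
    (I : Fin a → Fin (n + 1)) (J : Fin (b + 1) → Fin n) :
    mixedDeriv g (fun y => (F y).restrictLast) z c I J =
      (mixedDeriv g F z c).restrictLast I J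
        + (F z).contractVector (normal g z) I (fun i => J i.castSucc)
          * secondFFComp g z c (J (Fin.last b)) := by
  simp only [mixedDeriv, MixedTensor.restrictLast, MixedTensor.contractVector,
    Fin.sum_univ_castSucc (n := a), Fin.sum_univ_castSucc (n := b), Fin.snoc_castSucc,
    Fin.snoc_last, update_castSucc_castSucc,
    update_last_castSucc, Function.update_self, Fin.snoc_update, Fin.update_snoc_last,
    h.sum_christoffel_tangent_mul hz]
  have h1 : ∀ s : Fin b, ∀ e, Function.update J s.castSucc e (Fin.last b) = J (Fin.last b) :=
    fun s e => Function.update_of_ne (Fin.castSucc_lt_last s).ne' _ _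
  simp only [h1, mul_comm (F z _ _)]
  ring

/-- The Leibniz rule with `∇ν = -l^{*₁}`. This is how raised tensors enter the expressions. -/
theorem mixedDeriv_contractNormal {F : Coord n → MixedTensor n (a + 1) b}
    (hF : ∀ I J, ContDiffOn ℝ ∞ (fun y => F y I J) (Set.univ ∩ bdryIncl ⁻¹' U)) (c : Fin n)
    (I : Fin a → Fin (n + 1)) (J : Fin b → Fin n) :
    mixedDeriv g (fun y => (F y).contractVector (normal g y)) z c I J =
      (mixedDeriv g F z c).contractVector (normal g z) I J
        - ∑ e : Fin n, F z (Fin.snoc I e.succ) J *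
          sharp (bdryMetric g z) (secondFF g z) e (fun _ : Fin 1 => c) := by
  have h1 := fun I J => h.bdry.differentiableWithinAt (hF I J) (mem_bdry hz)
  have h3 : ∑ i, F z (Fin.snoc I i) J * pderiv Set.univ (fun y => normal g y i) c z =
      -(∑ e : Fin n, F z (Fin.snoc I e.succ) J *
          sharp (bdryMetric g z) (secondFF g z) e (fun _ : Fin 1 => c))
        - ∑ i, F z (Fin.snoc I i) J *
            ∑ j, christoffel (halfSpace n) g i c.succ j (bdryIncl z) * normal g z j := by
    rw [← sum_mul_pushTangent (fun i => F z (Fin.snoc I i) J) (fun e =>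
      sharp (bdryMetric g z) (secondFF g z) e (fun _ : Fin 1 => c)), ← Finset.sum_neg_distrib,
      ← Finset.sum_sub_distrib]
    refine Finset.sum_congr rfl fun i _ => ?_
    rw [← mul_neg, ← mul_sub, ← h.nablaNormal_eq hz i c]
    ring
  have h4 : ∑ i, F z (Fin.snoc I i) J *
      ∑ j, christoffel (halfSpace n) g i c.succ j (bdryIncl z) * normal g z j =
      ∑ j, (∑ i, christoffel (halfSpace n) g i c.succ j (bdryIncl z) * F z (Fin.snoc I i) J)
        * normal g z j := by
    simp only [Finset.mul_sum, Finset.sum_mul]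
    rw [Finset.sum_comm]
    exact Finset.sum_congr rfl fun i _ => Finset.sum_congr rfl fun j _ => by ring
  simp only [mixedDeriv, MixedTensor.contractVector, Fin.sum_univ_castSucc (n := a),
    Fin.snoc_castSucc, Fin.snoc_last, ← Fin.snoc_update, Fin.update_snoc_last, sub_mul, add_mul,
    Finset.sum_sub_distrib, Finset.sum_add_distrib]
  rw [pderiv_sum_mul c _ uniqueDiffWithinAt_univ (fun i _ => h1 _ _)
    (fun i _ => h.differentiableWithinAt_normal hz i), h3, h4]
  have h5 : ∀ {m p : ℕ} (A : Fin m → Fin p → ℝ) (B : Fin m → Fin p → Fin (n + 1) → ℝ),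
      ∑ s, ∑ i, A s i * ∑ j, B s i j * normal g z j =
        ∑ j, (∑ s, ∑ i, A s i * B s i j) * normal g z j := fun A B => by
    simp only [Finset.mul_sum, Finset.sum_mul, mul_assoc]
    rw [Finset.sum_congr rfl fun s _ => Finset.sum_comm, Finset.sum_comm]
  simp only [h5]
  ring

/-- The Leibniz rule, combined with the fact that `∇̄` commutes with raising the first entry. -/
theorem mixedDeriv_contractSharp {F : Coord n → MixedTensor n a (b + 1)}
    (hF : ∀ I J, ContDiffOn ℝ ∞ (fun y => F y I J) (Set.univ ∩ bdryIncl ⁻¹' U))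
    {T : TField n (r + 1)}
    (hT : ∀ I, ContDiffOn ℝ ∞ (fun y => T y I) (Set.univ ∩ bdryIncl ⁻¹' U)) (c : Fin n)
    (I : Fin a → Fin (n + 1)) (J : Fin (b + r) → Fin n) :
    mixedDeriv g (fun y => (F y).contractLast (sharp (bdryMetric g y) (T y))) z c I J =
      (mixedDeriv g F z c).contractLast (sharp (bdryMetric g z) (T z)) I J
        + ∑ e, F z I (Fin.snoc (fun i => J (Fin.castAdd r i)) e) *
          sharp (bdryMetric g z) (covDeriv Set.univ (bdryMetric g) T z) e
            (Fin.snoc (fun i => J (Fin.natAdd b i)) c) := by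
  have h1 := fun I J => h.bdry.differentiableWithinAt (hF I J) (mem_bdry hz)
  have h2 : ∀ e J, DifferentiableWithinAt ℝ (fun y => sharp (bdryMetric g y) (T y) e J)
      Set.univ z := fun e J => DifferentiableWithinAt.fun_sum fun d _ =>
    (h.bdry.differentiableWithinAt (h.bdry.contDiffOn_inv e d) (mem_bdry hz)).fun_mul
      (h.bdry.differentiableWithinAt (hT _) (mem_bdry hz))
  simp only [← h.pderiv_sharp hz hT]
  simp only [mixedDeriv, MixedTensor.contractLast, Fin.sum_univ_add (a := b) (b := r),
    update_castAdd_castAdd, update_castAdd_natAdd, update_natAdd_castAdd, update_natAdd_natAdd,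
    Fin.sum_univ_castSucc (n := b),
    Fin.snoc_castSucc, Fin.snoc_last, ← Fin.snoc_update, Fin.update_snoc_last, sub_mul, add_mul,
    mul_sub, mul_add, Finset.sum_sub_distrib, Finset.sum_add_distrib]
  rw [pderiv_sum_mul c _ uniqueDiffWithinAt_univ (fun i _ => h1 _ _) (fun i _ => h2 _ _)]
  have h5 : ∀ {m p q : ℕ} (A : Fin m → Fin p → ℝ) (B : Fin m → Fin p → Fin q → ℝ)
      (C : Fin q → ℝ), ∑ s, ∑ i, A s i * ∑ j, B s i j * C j =
        ∑ j, (∑ s, ∑ i, A s i * B s i j) * C j := fun A B C => by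
    simp only [Finset.mul_sum, Finset.sum_mul, mul_assoc]
    rw [Finset.sum_congr rfl fun s _ => Finset.sum_comm, Finset.sum_comm]
  have h6 : ∀ {m p q : ℕ} (A : Fin m → Fin p → ℝ) (B : Fin m → Fin p → Fin q → ℝ)
      (C : Fin q → ℝ), ∑ s, ∑ i, A s i * ∑ j, C j * B s i j =
        ∑ j, C j * (∑ s, ∑ i, A s i * B s i j) := fun A B C => by
    simp only [Finset.mul_sum, mul_left_comm _ (C _)]
    rw [Finset.sum_congr rfl fun s _ => Finset.sum_comm, Finset.sum_comm]
  have h7 : ∑ e, F z I (Fin.snoc (fun i => J (Fin.castAdd r i)) e) *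
      ∑ f, christoffel Set.univ (bdryMetric g) e c f z *
        sharp (bdryMetric g z) (T z) f (fun i => J (Fin.natAdd b i)) =
      ∑ f, (∑ e, christoffel Set.univ (bdryMetric g) e c f z *
        F z I (Fin.snoc (fun i => J (Fin.castAdd r i)) e)) *
        sharp (bdryMetric g z) (T z) f (fun i => J (Fin.natAdd b i)) := by
    simp only [Finset.mul_sum, Finset.sum_mul]
    rw [Finset.sum_comm]
    exact Finset.sum_congr rfl fun i _ => Finset.sum_congr rfl fun j _ => by ring
  -- The correction for the upper index of the raised tensor now has the shape of the correction for
  -- the contracted entry of `F`, and the two cancel.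
  rw [h7]
  simp only [h5, h6]
  ring

end

end IsMetricOn

namespace IsMetricOn

theorem contDiffOn_sharp {d r : ℕ} {S U : Set (Coord d)}
    {g : Coord d → Matrix (Fin d) (Fin d) ℝ} (h : IsMetricOn S U g) {T : TField d (r + 1)}
    (hT : ∀ I, ContDiffOn ℝ ∞ (fun y => T y I) (S ∩ U)) (i : Fin d) (J : Fin r → Fin d) :
    ContDiffOn ℝ ∞ (fun y => sharp (g y) (T y) i J) (S ∩ U) :=
  ContDiffOn.sum fun c _ => (h.contDiffOn_inv i c).mul (hT _)

theorem contDiffOn_eval {n : ℕ} {U : Set (Coord (n + 1))}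
    {g : Coord (n + 1) → Matrix (Fin (n + 1)) (Fin (n + 1)) ℝ}
    (h : IsMetricOn (halfSpace n) U g) {k a b : ℕ} (t : TensorExpr k a b)
    (I : Fin a → Fin (n + 1)) (J : Fin b → Fin n) :
    ContDiffOn ℝ ∞ (fun y => t.eval g y I J) (Set.univ ∩ bdryIncl ⁻¹' U) := by
  induction t with
  | nablaR j hj => exact contDiffOn_comp_bdryIncl (h.contDiffOn_nablaCurvature j I)
  | nablaL j hj => exact h.contDiffOn_nablaSecondFF j J
  | tensor s t ihs iht => exact (ihs _ _).mul (iht _ _)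
  | perm σ τ t ih => exact ih _ _
  | restrict t ih => exact ih _ _
  | contractNormal t ih => exact ContDiffOn.sum fun i _ => (ih _ _).mul (h.contDiffOn_normal i)
  | contractAmbient j hj t ih =>
    exact ContDiffOn.sum fun c _ =>
      (ih _ _).mul (h.bdry.contDiffOn_sharp (fun _ => h.contDiffOn_nablaSecondFF j _) c _)
  | contractBdry j hj t ih =>
    exact ContDiffOn.sum fun c _ =>
      (ih _ _).mul (h.bdry.contDiffOn_sharp (fun _ => h.contDiffOn_nablaSecondFF j _) c _)

end IsMetricOn

/-! ### Elementary operations on formal expressions -/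

namespace TensorExpr

/-- An expression of order `k`, viewed as an expression of order `k + 1`. -/
def lift {k : ℕ} : {a b : ℕ} → TensorExpr k a b → TensorExpr (k + 1) a b
  | _, _, .nablaR j hj => .nablaR j (hj.trans k.le_succ)
  | _, _, .nablaL j hj => .nablaL j (hj.trans k.le_succ)
  | _, _, .tensor s t => .tensor s.lift t.lift
  | _, _, .perm σ τ t => .perm σ τ t.lift
  | _, _, .restrict t => .restrict t.lift
  | _, _, .contractNormal t => .contractNormal t.lift
  | _, _, .contractAmbient j hj t => .contractAmbient j (hj.trans k.lt_succ_self) t.lift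
  | _, _, .contractBdry j hj t => .contractBdry j (hj.trans k.lt_succ_self) t.lift

/-- An expression without contractions with `ν`. -/
def NormalFree {k : ℕ} : {a b : ℕ} → TensorExpr k a b → Prop
  | _, _, .nablaR _ _ => True
  | _, _, .nablaL _ _ => True
  | _, _, .tensor s t => s.NormalFree ∧ t.NormalFree
  | _, _, .perm _ _ t => t.NormalFree
  | _, _, .restrict t => t.NormalFree
  | _, _, .contractNormal _ => False
  | _, _, .contractAmbient _ _ t => t.NormalFree
  | _, _, .contractBdry _ _ t => t.NormalFree

/-- A bijection forces `b = b'`, so this is a permutation. The form with two ranks absorbs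
equalities such as `b + 1 + r = b + r + 1`. -/
theorem exists_reindex {k a b b' : ℕ} (τ : Fin b ≃ Fin b') (t : TensorExpr k a b) :
    ∃ t' : TensorExpr k a b', ∀ (n : ℕ) (g : Coord (n + 1) → Matrix (Fin (n + 1)) (Fin (n + 1)) ℝ)
      (z : Coord n), (t'.eval g z : MixedTensor n a b') = fun I J => t.eval g z I fun i => J (τ i) := by
  obtain rfl : b = b' := Fin.equiv_iff_eq.1 ⟨τ⟩
  exact ⟨.perm (Equiv.refl _) τ t, fun n g z => rfl⟩

variable {k n a b : ℕ} (g : Coord (n + 1) → Matrix (Fin (n + 1)) (Fin (n + 1)) ℝ) (z : Coord n)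

theorem eval_lift (t : TensorExpr k a b) : t.lift.eval g z = t.eval g z := by
  induction t with
  | nablaR j hj => rfl
  | nablaL j hj => rfl
  | tensor s t ihs iht => funext I J; simp only [lift, eval, ihs, iht]
  | perm σ τ t ih => funext I J; simp only [lift, eval, ih]
  | restrict t ih => funext I J; simp only [lift, eval, ih]
  | contractNormal t ih => funext I J; simp only [lift, eval, ih]
  | contractAmbient j hj t ih => funext I J; simp only [lift, eval, ih]
  | contractBdry j hj t ih => funext I J; simp only [lift, eval, ih]

theorem eval_tensor {a' b' : ℕ} (s : TensorExpr k a b) (t : TensorExpr k a' b') :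
    (s.tensor t).eval g z = MixedTensor.prod (s.eval g z) (t.eval g z) := rfl

theorem eval_perm (σ : Equiv.Perm (Fin a)) (τ : Equiv.Perm (Fin b)) (t : TensorExpr k a b) :
    (perm σ τ t).eval g z = MixedTensor.permute σ τ (t.eval g z) := rfl

theorem eval_restrict (t : TensorExpr k (a + 1) b) :
    (restrict t).eval g z = MixedTensor.restrictLast (t.eval g z) := rfl

theorem eval_contractNormal (t : TensorExpr k (a + 1) b) :
    (contractNormal t).eval g z = MixedTensor.contractVector (normal g z) (t.eval g z) := rfl

theorem eval_contractBdry (j : ℕ) (hj : j + 1 < k) (t : TensorExpr k a (b + 1)) :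
    (contractBdry j hj t).eval g z = MixedTensor.contractLast
      (sharp (bdryMetric g z) (nablaSecondFF g j z)) (t.eval g z) := rfl

/-- The vectors inserted are tangent to the boundary, so the entry may be restricted first.
Contractions of ambient entries thereby reduce to boundary contractions. -/
theorem eval_contractAmbient (j : ℕ) (hj : j + 1 < k) (t : TensorExpr k (a + 1) b) :
    (contractAmbient j hj t).eval g z = (contractBdry j hj (restrict t)).eval g z := by
  funext I J
  simp [eval]

end TensorExpr

/-! ### Tensors given by universal expressions -/

/-- A mixed tensor along the boundary that depends on the dimension and the metric. -/
abbrev MixedFamily (a b : ℕ) : Type :=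
  ∀ n : ℕ, (Coord (n + 1) → Matrix (Fin (n + 1)) (Fin (n + 1)) ℝ) → Coord n → MixedTensor n a b

/-- The integer linear combination of expressions given by a list. -/
noncomputable def evalList {k a b : ℕ} (L : List (ℤ × TensorExpr k a b)) : MixedFamily a b :=
  fun _ g z => (L.map fun t => (t.1 : ℝ) • t.2.eval g z).sum

/-- The family is an integer linear combination of expressions of order `k`, for all metrics. -/
def IsExpr (k : ℕ) {a b : ℕ} (F : MixedFamily a b) : Prop :=
  ∃ L : List (ℤ × TensorExpr k a b), ∀ (n : ℕ) (U : Set (Coord (n + 1)))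
    (g : Coord (n + 1) → Matrix (Fin (n + 1)) (Fin (n + 1)) ℝ), IsMetricOn (halfSpace n) U g →
    ∀ z : Coord n, bdryIncl z ∈ U → F n g z = evalList L n g z

/-- The covariant derivative of a family; the new entry is the last one in `T∂M`. -/
noncomputable def familyDeriv {a b : ℕ} (F : MixedFamily a b) : MixedFamily a (b + 1) :=
  fun n g z I J => mixedDeriv g (F n g) z (J (Fin.last b)) I fun i => J i.castSucc

theorem evalList_cons {k a b : ℕ} (t : ℤ × TensorExpr k a b) (L : List (ℤ × TensorExpr k a b))
    (n : ℕ) (g : Coord (n + 1) → Matrix (Fin (n + 1)) (Fin (n + 1)) ℝ) (z : Coord n) :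
    evalList (t :: L) n g z = (t.1 : ℝ) • t.2.eval g z + evalList L n g z := by
  simp [evalList]

theorem evalList_apply {k a b : ℕ} (L : List (ℤ × TensorExpr k a b))
    (n : ℕ) (g : Coord (n + 1) → Matrix (Fin (n + 1)) (Fin (n + 1)) ℝ) (z : Coord n)
    (I : Fin a → Fin (n + 1)) (J : Fin b → Fin n) :
    evalList L n g z I J = (L.map fun t => (t.1 : ℝ) * t.2.eval g z I J).sum := by
  induction L with
  | nil => rfl
  | cons t L ih => simp [evalList_cons, ih]

namespace IsExpr

variable {k a b : ℕ} {F F' : MixedFamily a b}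

theorem congr (h : IsExpr k F) (hF : ∀ (n : ℕ) (U : Set (Coord (n + 1)))
    (g : Coord (n + 1) → Matrix (Fin (n + 1)) (Fin (n + 1)) ℝ), IsMetricOn (halfSpace n) U g →
    ∀ z : Coord n, bdryIncl z ∈ U → F' n g z = F n g z) : IsExpr k F' := by
  obtain ⟨L, hL⟩ := h
  exact ⟨L, fun n U g hg z hz => (hF n U g hg z hz).trans (hL n U g hg z hz)⟩

theorem eval (t : TensorExpr k a b) : IsExpr k fun n g z => (t.eval g z : MixedTensor n a b) :=
  ⟨[(1, t)], fun n U g _ z _ => by simp [evalList]⟩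

theorem zero : IsExpr k (fun _ _ _ => 0 : MixedFamily a b) :=
  ⟨[], fun n U g _ z _ => by simp [evalList]⟩

theorem add (h : IsExpr k F) (h' : IsExpr k F') : IsExpr k fun n g z => F n g z + F' n g z := by
  obtain ⟨L, hL⟩ := h
  obtain ⟨L', hL'⟩ := h'
  exact ⟨L ++ L', fun n U g hg z hz => by
    simp only [hL n U g hg z hz, hL' n U g hg z hz, evalList, List.map_append, List.sum_append]⟩

theorem smul (c : ℤ) (h : IsExpr k F) : IsExpr k fun n g z => (c : ℝ) • F n g z := by
  obtain ⟨L, hL⟩ := h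
  refine ⟨L.map fun t => (c * t.1, t.2), fun n U g hg z hz => ?_⟩
  simp only [hL n U g hg z hz, evalList, List.map_map, List.smul_sum, Function.comp_def,
    Int.cast_mul, mul_smul]

/-- Linear operations that act on expressions preserve integer combinations of expressions. -/
theorem map {k' a' b' : ℕ} (op : TensorExpr k a b → TensorExpr k' a' b')
    (Φ : ∀ n, (Coord (n + 1) → Matrix (Fin (n + 1)) (Fin (n + 1)) ℝ) → Coord n →
      MixedTensor n a b → MixedTensor n a' b')
    (hΦ : ∀ n g z, IsLinearMap ℝ (Φ n g z))
    (hop : ∀ n g (z : Coord n) t, (op t).eval g z = Φ n g z (t.eval g z)) (h : IsExpr k F) :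
    IsExpr k' fun n g z => Φ n g z (F n g z) := by
  obtain ⟨L, hL⟩ := h
  refine ⟨L.map fun t => (t.1, op t.2), fun n U g hg z hz => ?_⟩
  simp only [hL n U g hg z hz]
  clear hL
  induction L with
  | nil => exact (hΦ n g z).map_zero
  | cons t L ih => rw [List.map_cons, evalList_cons, evalList_cons, (hΦ n g z).map_add, ih,
      (hΦ n g z).map_smul, hop]

theorem reindex {b' : ℕ} (τ : Fin b ≃ Fin b') (h : IsExpr k F) :
    IsExpr k (fun n g z I J => F n g z I fun i => J (τ i) : MixedFamily a b') := by
  choose op hop using TensorExpr.exists_reindex (k := k) (a := a) τ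
  exact h.map op (fun _ _ _ T I J => T I fun i => J (τ i)) (fun _ _ _ => ⟨fun _ _ => rfl,
    fun _ _ => rfl⟩) fun n g z t => hop t n g z

theorem prod_eval {a' b' : ℕ} (h : IsExpr k F) (t : TensorExpr k a' b') :
    IsExpr k fun n g z => (F n g z).prod (t.eval g z) :=
  h.map (fun s => s.tensor t) (fun n g z T => T.prod (t.eval g z))
    (fun n g z => ⟨fun _ _ => by funext I J; simp [MixedTensor.prod, add_mul],
      fun _ _ => by funext I J; simp [MixedTensor.prod, mul_assoc]⟩) fun _ _ _ _ => rfl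

theorem eval_prod {a' b' : ℕ} (t : TensorExpr k a' b') (h : IsExpr k F) :
    IsExpr k fun n g z => MixedTensor.prod (t.eval g z) (F n g z) :=
  h.map (fun s => t.tensor s) (fun n g z T => MixedTensor.prod (t.eval g z) T)
    (fun n g z => ⟨fun _ _ => by funext I J; simp [MixedTensor.prod, mul_add],
      fun _ _ => by funext I J; simp [MixedTensor.prod, mul_left_comm]⟩) fun _ _ _ _ => rfl

theorem permute (σ : Equiv.Perm (Fin a)) (τ : Equiv.Perm (Fin b)) (h : IsExpr k F) :
    IsExpr k fun n g z => (F n g z).permute σ τ :=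
  h.map (.perm σ τ) (fun _ _ _ T => T.permute σ τ) (fun _ _ _ => ⟨fun _ _ => rfl, fun _ _ => rfl⟩)
    fun _ _ _ _ => rfl

theorem restrictLast {F : MixedFamily (a + 1) b} (h : IsExpr k F) :
    IsExpr k fun n g z => (F n g z).restrictLast :=
  h.map .restrict (fun _ _ _ T => T.restrictLast) (fun _ _ _ => ⟨fun _ _ => rfl, fun _ _ => rfl⟩)
    fun _ _ _ _ => rfl

theorem contractNormal {F : MixedFamily (a + 1) b} (h : IsExpr k F) :
    IsExpr k fun n g z => (F n g z).contractVector (normal g z) :=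
  h.map .contractNormal (fun n g z T => T.contractVector (normal g z))
    (fun n g z => ⟨fun _ _ => by
        funext I J; simp [MixedTensor.contractVector, add_mul, Finset.sum_add_distrib],
      fun _ _ => by
        funext I J; simp [MixedTensor.contractVector, Finset.mul_sum, mul_assoc]⟩)
    fun _ _ _ _ => rfl

theorem contractSharp {F : MixedFamily a (b + 1)} (j : ℕ) (hj : j + 1 < k) (h : IsExpr k F) :
    IsExpr k fun n g z =>
      (F n g z).contractLast (sharp (bdryMetric g z) (nablaSecondFF g j z)) :=
  h.map (.contractBdry j hj)
    (fun n g z T => T.contractLast (sharp (bdryMetric g z) (nablaSecondFF g j z)))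
    (fun n g z => ⟨fun _ _ => by
        funext I J; simp [MixedTensor.contractLast, add_mul, Finset.sum_add_distrib],
      fun _ _ => by
        funext I J; simp [MixedTensor.contractLast, Finset.mul_sum, mul_assoc]⟩)
    fun _ _ _ _ => rfl

end IsExpr

/-- The bijection that moves the entry with number `b` to the end. -/
def moveToEnd (b r : ℕ) : Fin (b + 1 + r) ≃ Fin (b + r + 1) where
  toFun i := ⟨if i.1 < b then i.1 else if i.1 = b then b + r else i.1 - 1, by
    have := i.2
    split_ifs <;> omega⟩
  invFun i := ⟨if i.1 < b then i.1 else if i.1 = b + r then b else i.1 + 1, by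
    have := i.2
    split_ifs <;> omega⟩
  left_inv i := by
    ext
    have := i.2
    dsimp only
    split_ifs <;> omega
  right_inv i := by
    ext
    have := i.2
    dsimp only
    split_ifs <;> omega

theorem moveToEnd_castSucc (b r : ℕ) (i : Fin b) :
    moveToEnd b r (Fin.castAdd r i.castSucc) = (Fin.castAdd r i).castSucc := by
  ext
  simp [moveToEnd]

theorem moveToEnd_last (b r : ℕ) : moveToEnd b r (Fin.castAdd r (Fin.last b)) = Fin.last _ := by
  ext
  simp [moveToEnd]

theorem moveToEnd_natAdd (b r : ℕ) (i : Fin r) :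
    moveToEnd b r (Fin.natAdd (b + 1) i) = (Fin.natAdd b i).castSucc := by
  ext
  have h1 : ¬ (b + 1 + i.1 < b) := by omega
  have h2 : ¬ (b + 1 + i.1 = b) := by omega
  simp [moveToEnd, h1, h2]

/-! ### Covariant derivatives of universal expressions -/

namespace TensorExpr

variable {k a b : ℕ}

/-- The directions of differentiation are tangent to the boundary, so the result is `∇ʲ⁺¹ R` with
its last entry, the direction, restricted. -/
theorem isExpr_deriv_nablaR (j : ℕ) (hj : j ≤ k) :
    IsExpr (k + 1) (familyDeriv fun _ g z => (nablaR j hj : TensorExpr k _ _).eval g z) := by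
  refine ((IsExpr.eval (nablaR (j + 1) (Nat.succ_le_succ hj))).restrictLast).congr
    fun n U g h z hz => ?_
  funext I J
  change mixedDeriv g (fun z I _ => nablaCurvature (halfSpace n) g j (bdryIncl z) I) z _ _ _ =
    covDeriv (halfSpace n) g (nablaCurvature (halfSpace n) g j) (bdryIncl z) _
  simp only [mixedDeriv, covDeriv, Fin.snoc_castSucc, Fin.snoc_last, Finset.univ_eq_empty,
    Finset.sum_empty, sub_zero]
  rw [h.pderiv_comp_bdryIncl hz (h.contDiffOn_nablaCurvature j I)]

theorem isExpr_deriv_nablaL (j : ℕ) (hj : j ≤ k) :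
    IsExpr (k + 1) (familyDeriv fun _ g z => (nablaL j hj : TensorExpr k _ _).eval g z) := by
  refine (IsExpr.eval (nablaL (j + 1) (Nat.succ_le_succ hj))).congr fun n U g h z hz => ?_
  funext I J
  change mixedDeriv g (fun z _ J => nablaSecondFF g j z J) z _ _ _ =
    covDeriv Set.univ (bdryMetric g) (nablaSecondFF g j) z J
  simp only [mixedDeriv, covDeriv, Finset.univ_eq_empty, Finset.sum_empty, sub_zero]

/-- When the derivative falls on `s`, the direction lies between the entries of `s` and those of
`t`; `moveToEnd` puts it last. -/
theorem isExpr_deriv_tensor {a' b' : ℕ} (s : TensorExpr k a b) (t : TensorExpr k a' b')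
    (hs : IsExpr (k + 1) (familyDeriv fun _ g z => s.eval g z))
    (ht : IsExpr (k + 1) (familyDeriv fun _ g z => t.eval g z)) :
    IsExpr (k + 1) (familyDeriv fun _ g z => (s.tensor t).eval g z) := by
  refine (((hs.prod_eval t.lift).reindex (moveToEnd b b')).add (ht.eval_prod s.lift)).congr
    fun n U g h z hz => ?_
  funext I J
  rw [familyDeriv, Pi.add_apply, Pi.add_apply, eval_lift, eval_lift]
  change mixedDeriv g (fun z => MixedTensor.prod (s.eval g z) (t.eval g z)) z _ _ _ = _
  rw [h.mixedDeriv_prod hz (fun _ _ => h.contDiffOn_eval s _ _) fun _ _ => h.contDiffOn_eval t _ _]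
  simp only [Pi.add_apply, MixedTensor.prod, familyDeriv, moveToEnd_castSucc, moveToEnd_last,
    moveToEnd_natAdd]
  rfl

theorem isExpr_deriv_perm (σ : Equiv.Perm (Fin a)) (τ : Equiv.Perm (Fin b))
    (t : TensorExpr k a b) (ht : IsExpr (k + 1) (familyDeriv fun _ g z => t.eval g z)) :
    IsExpr (k + 1) (familyDeriv fun _ g z => (perm σ τ t).eval g z) := by
  -- The extension of `τ` that fixes the last entry, the direction of differentiation.
  let τ' : Equiv.Perm (Fin (b + 1)) := finSumFinEquiv.symm.trans
    ((Equiv.sumCongr τ (Equiv.refl (Fin 1))).trans finSumFinEquiv)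
  have h1 : ∀ i : Fin b, τ' i.castSucc = (τ i).castSucc := fun i => by
    change finSumFinEquiv (Sum.map τ id (finSumFinEquiv.symm (Fin.castAdd 1 i))) = _
    rw [finSumFinEquiv_symm_apply_castAdd]
    rfl
  have h2 : τ' (Fin.last b) = Fin.last b := by
    change finSumFinEquiv (Sum.map τ id (finSumFinEquiv.symm (Fin.natAdd b (0 : Fin 1)))) = _
    rw [finSumFinEquiv_symm_apply_natAdd]
    rfl
  refine (ht.permute σ τ').congr fun n U g h z hz => ?_
  funext I J
  change mixedDeriv g (fun z => MixedTensor.permute σ τ (t.eval g z)) z _ _ _ = _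
  rw [IsMetricOn.mixedDeriv_permute]
  simp only [MixedTensor.permute, familyDeriv, h1, h2]

theorem isExpr_deriv_restrict (t : TensorExpr k (a + 1) b)
    (ht : IsExpr (k + 1) (familyDeriv fun _ g z => t.eval g z)) :
    IsExpr (k + 1) (familyDeriv fun _ g z => (restrict t).eval g z) := by
  -- In the first term `moveToEnd b 1` exchanges the direction with the newly restricted entry. The
  -- second term has the direction as the last argument of `l`, which is allowed since `l` is
  -- symmetric.
  refine ((ht.restrictLast.reindex (moveToEnd b 1)).add
    (IsExpr.eval (tensor (contractNormal t.lift) (nablaL 0 (Nat.zero_le _))))).congr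
    fun n U g h z hz => ?_
  funext I J
  rw [Pi.add_apply, Pi.add_apply, eval_tensor, eval_contractNormal, eval_lift]
  change mixedDeriv g (fun z => MixedTensor.restrictLast (t.eval g z)) z _ _ _ = _ + _ *
    secondFF g z (fun i : Fin 2 => J (Fin.natAdd b i))
  rw [h.mixedDeriv_restrictLast hz, secondFF_eq_comp, h.secondFFComp_symm hz]
  have h1 : ∀ i : Fin b, moveToEnd b 1 i.castSucc.castSucc = i.castSucc.castSucc :=
    fun i => moveToEnd_castSucc b 1 i
  have h2 : moveToEnd b 1 (Fin.last (b + 1)) = (Fin.last b).castSucc := moveToEnd_natAdd b 1 0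
  have h3 : moveToEnd b 1 (Fin.last b).castSucc = Fin.last (b + 1) := moveToEnd_last b 1
  simp only [MixedTensor.restrictLast, familyDeriv, h1, h2, h3]
  rfl

/-- The new block `l^{*₁}` is admissible in order `k + 1` only if `0 + 1 < k + 1`; hence the
hypothesis `1 ≤ k`. -/
theorem isExpr_deriv_contractNormal (hk : 1 ≤ k) (t : TensorExpr k (a + 1) b)
    (ht : IsExpr (k + 1) (familyDeriv fun _ g z => t.eval g z)) :
    IsExpr (k + 1) (familyDeriv fun _ g z => (contractNormal t).eval g z) := by
  refine (ht.contractNormal.add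
    ((IsExpr.eval (contractAmbient 0 (by omega) t.lift)).smul (-1))).congr fun n U g h z hz => ?_
  funext I J
  change mixedDeriv g (fun z => MixedTensor.contractVector (normal g z) (t.eval g z)) z _ _ _ = _
  rw [h.mixedDeriv_contractNormal hz fun _ _ => h.contDiffOn_eval t _ _]
  simp only [Pi.add_apply, Pi.smul_apply, TensorExpr.eval, eval_lift, smul_eq_mul, Int.cast_neg,
    Int.cast_one, neg_one_mul, sub_eq_add_neg]
  congr 3

theorem isExpr_deriv_contractBdry (j : ℕ) (hj : j + 1 < k) (t : TensorExpr k a (b + 1))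
    (ht : IsExpr (k + 1) (familyDeriv fun _ g z => t.eval g z)) :
    IsExpr (k + 1) (familyDeriv fun _ g z => (contractBdry j hj t).eval g z) := by
  have hj' : j + 1 < k + 1 := hj.trans k.lt_succ_self
  -- The first reindexing puts the contracted entry behind the direction, so that it is last; after
  -- the contraction the second one moves the direction behind the `j + 1` new entries. In the other
  -- term the direction already ends the entries of `∇̄ʲ⁺¹ l`.
  refine (((((ht.reindex (moveToEnd b 1)).contractSharp j hj').reindex
    (moveToEnd b (j + 1)))).add
    (IsExpr.eval (contractBdry (j + 1) (Nat.succ_lt_succ hj) t.lift))).congr fun n U g h z hz => ?_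
  funext I J
  rw [Pi.add_apply, Pi.add_apply, eval_contractBdry, eval_lift]
  change mixedDeriv g (fun z => MixedTensor.contractLast
    (sharp (bdryMetric g z) (nablaSecondFF g j z)) (t.eval g z)) z _ _ _ = _
  rw [h.mixedDeriv_contractSharp hz (fun _ _ => h.contDiffOn_eval t _ _)
    fun _ => h.contDiffOn_nablaSecondFF j _]
  have h1 : ∀ i : Fin b, moveToEnd b 1 i.castSucc.castSucc = i.castSucc.castSucc :=
    fun i => moveToEnd_castSucc b 1 i
  have h2 : moveToEnd b 1 (Fin.last (b + 1)) = (Fin.last b).castSucc := moveToEnd_natAdd b 1 0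
  have h3 : moveToEnd b 1 (Fin.last b).castSucc = Fin.last (b + 1) := moveToEnd_last b 1
  congr 1
  · simp only [MixedTensor.contractLast, familyDeriv]
    refine Finset.sum_congr rfl fun e _ => ?_
    have h4 : (fun i : Fin (b + 1) => (Fin.snoc (fun i : Fin (b + 1) =>
        J (moveToEnd b (j + 1) (Fin.castAdd (j + 1) i))) e : Fin (b + 2) → Fin n)
          (moveToEnd b 1 i.castSucc)) =
        Fin.snoc (fun i => J (Fin.castAdd (j + 1) i).castSucc) e := by
      funext i
      refine Fin.lastCases ?_ (fun i => ?_) i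
      · rw [h3, Fin.snoc_last, Fin.snoc_last]
      · rw [h1, Fin.snoc_castSucc, Fin.snoc_castSucc, moveToEnd_castSucc]
    have h5 : (Fin.snoc (fun i : Fin (b + 1) => J (moveToEnd b (j + 1) (Fin.castAdd (j + 1) i))) e :
        Fin (b + 2) → Fin n) (Fin.last b).castSucc = J (Fin.last (b + (j + 1))) := by
      rw [Fin.snoc_castSucc, moveToEnd_last]
    simp only [moveToEnd_natAdd, h2, h4, h5]
  · simp only [MixedTensor.contractLast]
    refine Finset.sum_congr rfl fun e _ => ?_
    congr 2
    funext i
    refine Fin.lastCases ?_ (fun i => ?_) i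
    · rw [Fin.snoc_last]
      rfl
    · rw [Fin.snoc_castSucc]
      rfl

/-- The covariant derivative of an expression of order `k` is a combination of expressions of
order `k + 1`. -/
theorem isExpr_familyDeriv_eval (t : TensorExpr k a b) (ht : 1 ≤ k ∨ t.NormalFree) :
    IsExpr (k + 1) (familyDeriv fun _ g z => t.eval g z) := by
  induction t with
  | nablaR j hj => exact isExpr_deriv_nablaR j hj
  | nablaL j hj => exact isExpr_deriv_nablaL j hj
  | tensor s t ihs iht =>
    exact isExpr_deriv_tensor s t (ihs (ht.imp_right And.left)) (iht (ht.imp_right And.right))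
  | perm σ τ t ih => exact isExpr_deriv_perm σ τ t (ih ht)
  | restrict t ih => exact isExpr_deriv_restrict t (ih ht)
  | contractNormal t ih =>
    -- A contraction with `ν` is never `NormalFree`, so the other alternative holds.
    have hk : 1 ≤ k := ht.resolve_right id
    exact isExpr_deriv_contractNormal hk t (ih (Or.inl hk))
  | contractAmbient j hj t ih =>
    have h1 := isExpr_deriv_contractBdry j hj _ (isExpr_deriv_restrict t (ih ht))
    simp only [← eval_contractAmbient] at h1
    exact h1
  | contractBdry j hj t ih => exact isExpr_deriv_contractBdry j hj t (ih ht)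

end TensorExpr

theorem IsMetricOn.contDiffOn_evalList {n : ℕ} {U : Set (Coord (n + 1))}
    {g : Coord (n + 1) → Matrix (Fin (n + 1)) (Fin (n + 1)) ℝ}
    (h : IsMetricOn (halfSpace n) U g) {k a b : ℕ} (L : List (ℤ × TensorExpr k a b))
    (I : Fin a → Fin (n + 1)) (J : Fin b → Fin n) :
    ContDiffOn ℝ ∞ (fun y => evalList L n g y I J) (Set.univ ∩ bdryIncl ⁻¹' U) := by
  induction L with
  | nil => exact contDiffOn_const (c := (0 : ℝ))
  | cons t L ih =>
    simp only [evalList_cons]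
    exact (contDiffOn_const.mul (h.contDiffOn_eval t.2 I J)).add ih

theorem isExpr_familyDeriv_evalList {k a b : ℕ} (L : List (ℤ × TensorExpr k a b))
    (hL : ∀ t ∈ L, 1 ≤ k ∨ t.2.NormalFree) :
    IsExpr (k + 1) (familyDeriv (evalList L)) := by
  induction L with
  | nil =>
    refine IsExpr.zero.congr fun n U g h z hz => ?_
    funext I J
    change pderiv Set.univ (fun _ => 0) _ z - _ - _ = 0
    simp [pderiv_const, evalList]
  | cons t L ih =>
    refine (((TensorExpr.isExpr_familyDeriv_eval t.2 (hL t (by simp))).smul t.1).add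
      (ih fun s hs => hL s (by simp [hs]))).congr fun n U g h z hz => ?_
    funext I J
    rw [familyDeriv, funext fun y => evalList_cons t L n g y,
      h.mixedDeriv_add_smul hz (F := fun y => t.2.eval g y) (F' := evalList L n g)
        (fun _ _ => h.contDiffOn_eval t.2 _ _) fun _ _ => h.contDiffOn_evalList L _ _]
    rfl

/-- The curvature of the boundary as a sum of expressions, by the Gauss equation. -/
theorem exists_evalList_curvature : ∃ L : List (ℤ × TensorExpr 0 0 4),
    (∀ t ∈ L, t.2.NormalFree) ∧ ∀ (n : ℕ) (U : Set (Coord (n + 1)))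
      (g : Coord (n + 1) → Matrix (Fin (n + 1)) (Fin (n + 1)) ℝ),
      IsMetricOn (halfSpace n) U g → ∀ z : Coord n, bdryIncl z ∈ U →
      ∀ I J, nablaCurvature Set.univ (bdryMetric g) 0 z J = evalList L n g z I J := by
  -- Each restriction takes the last entry in `TM` and appends it in `T∂M`; four of them reverse the
  -- order, which `Fin.revPerm` undoes.
  let R : TensorExpr 0 0 4 := .perm (Equiv.refl _) (Fin.revPerm : Equiv.Perm (Fin 4))
    (.restrict (.restrict (.restrict (.restrict (.nablaR 0 le_rfl)))))
  let l : TensorExpr 0 0 2 := .nablaL 0 le_rfl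
  let A : TensorExpr 0 0 4 := .perm (Equiv.refl _) (Equiv.swap (1 : Fin 4) 2) (.tensor l l)
  let B : TensorExpr 0 0 4 := .perm (Equiv.refl _)
    ((Equiv.swap (1 : Fin 4) 2).trans (Equiv.swap (2 : Fin 4) 3)) (.tensor l l)
  refine ⟨[(1, R), (1, A), (-1, B)], ?_, ?_⟩
  · simp [R, A, B, l, TensorExpr.NormalFree]
  · intro n U g h z hz I J
    change curvature Set.univ (bdryMetric g) z J = _
    have hR : R.eval g z I J = curvature (halfSpace n) g (bdryIncl z) fun s => (J s).succ := by
      simp only [R, TensorExpr.eval]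
      change curvature (halfSpace n) g (bdryIncl z) _ = _
      congr 1
      funext s
      fin_cases s <;> rfl
    have hl : ∀ K, nablaSecondFF g 0 z K = secondFFComp g z (K 0) (K 1) := secondFF_eq_comp g z
    have hA : A.eval g z I J = secondFFComp g z (J 0) (J 2) * secondFFComp g z (J 1) (J 3) := by
      simp only [A, l, TensorExpr.eval, hl]
      congr 1
    have hB : B.eval g z I J = secondFFComp g z (J 0) (J 3) * secondFFComp g z (J 1) (J 2) := by
      simp only [B, l, TensorExpr.eval, hl]
      congr 1
    rw [h.curvature_bdryMetric hz]
    simp [evalList, hR, hA, hB]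
    ring

/-- All covariant derivatives of the curvature of the boundary are integer linear combinations of
expressions. -/
theorem exists_evalList_nablaCurvature (k : ℕ) : ∃ L : List (ℤ × TensorExpr k 0 (k + 4)),
    (∀ t ∈ L, 1 ≤ k ∨ t.2.NormalFree) ∧ ∀ (n : ℕ) (U : Set (Coord (n + 1)))
      (g : Coord (n + 1) → Matrix (Fin (n + 1)) (Fin (n + 1)) ℝ),
      IsMetricOn (halfSpace n) U g → ∀ z : Coord n, bdryIncl z ∈ U →
      ∀ I J, nablaCurvature Set.univ (bdryMetric g) k z J = evalList L n g z I J := by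
  induction k with
  | zero =>
    obtain ⟨L, hL, h⟩ := exists_evalList_curvature
    exact ⟨L, fun t ht => Or.inr (hL t ht), h⟩
  | succ k ih =>
    obtain ⟨L, hL, h⟩ := ih
    obtain ⟨L', hL'⟩ := isExpr_familyDeriv_evalList L hL
    -- Only the first step needs expressions without `ν`; from order 1 on, `ν` may occur freely.
    refine ⟨L', fun t _ => Or.inl (Nat.le_add_left 1 k), fun n U g hg z hz I J => ?_⟩
    rw [← hL' n U g hg z hz]
    change covDeriv Set.univ (bdryMetric g) (nablaCurvature Set.univ (bdryMetric g) k) z J = _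
    -- The formula of order `k` may be differentiated because it holds at all boundary points in the
    -- open set `U`, not only at `z`.
    rw [familyDeriv, ← hg.mixedDeriv_congr hz
      (F := fun z _ J => nablaCurvature Set.univ (bdryMetric g) k z J)
      fun y hy => by funext I J; exact h n U g hg y hy I J]
    simp only [mixedDeriv, covDeriv, Finset.univ_eq_empty, Finset.sum_empty, sub_zero]

/-! ### Components in orthonormal frames and norms -/

section Sums

variable {α : Type*} [Fintype α] {m p : ℕ}

theorem sum_fin_succ_eq_sum_snoc (f : (Fin (m + 1) → α) → ℝ) :
    ∑ I, f I = ∑ I : Fin m → α, ∑ i, f (Fin.snoc I i) := by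
  rw [← (Fin.snocEquiv fun _ => α).sum_comp, Fintype.sum_prod_type, Finset.sum_comm]
  rfl

theorem sum_fin_add_eq_sum_append (f : (Fin (m + p) → α) → ℝ) :
    ∑ I, f I = ∑ I : Fin m → α, ∑ I' : Fin p → α, f (Fin.append I I') := by
  rw [← (Fin.appendEquiv m p).sum_comp, Fintype.sum_prod_type]
  rfl

theorem sum_comp_perm (σ : Equiv.Perm (Fin m)) (f : (Fin m → α) → ℝ) :
    ∑ I : Fin m → α, f (fun i => I (σ i)) = ∑ I, f I :=
  (Equiv.arrowCongr σ.symm (Equiv.refl α)).sum_comp f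

theorem sum_sum_mul_eq {ι γ δ : Type*} [Fintype ι] [Fintype γ] [Fintype δ]
    (p : ι → ℝ) (q : δ → ℝ) (t : ι → γ → ℝ) (m : γ → γ → ℝ) (s : γ → δ → ℝ) :
    ∑ i, ∑ d, p i * q d * ∑ c, t i c * ∑ c', m c c' * s c' d =
      ∑ c, ∑ c', (∑ i, p i * t i c) * m c c' * ∑ d, q d * s c' d := by
  simp only [Finset.mul_sum, Finset.sum_mul]
  rw [Finset.sum_congr rfl fun x _ => Finset.sum_comm, Finset.sum_comm]
  refine Finset.sum_congr rfl fun c _ => ?_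
  rw [Finset.sum_congr rfl fun x _ => Finset.sum_comm, Finset.sum_comm]
  refine Finset.sum_congr rfl fun c' _ => ?_
  rw [Finset.sum_comm]
  exact Finset.sum_congr rfl fun d _ => Finset.sum_congr rfl fun x _ => by ring

theorem sum_sum_sum_mul_eq {ι κ γ δ : Type*} [Fintype ι] [Fintype κ] [Fintype γ] [Fintype δ]
    (p : ι → κ → ℝ) (q : δ → ℝ) (t : ι → κ → γ → ℝ) (m : γ → γ → ℝ) (s : γ → δ → ℝ) :
    ∑ i, ∑ j, ∑ d, p i j * q d * ∑ c, t i j c * ∑ c', m c c' * s c' d =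
      ∑ c, ∑ c', (∑ i, ∑ j, p i j * t i j c) * m c c' * ∑ d, q d * s c' d := by
  have h := sum_sum_mul_eq (fun x : ι × κ => p x.1 x.2) q (fun x => t x.1 x.2) m s
  simpa only [Fintype.sum_prod_type] using h

theorem sum_sum_mul_sum_mul_eq {γ : Type*} [Fintype γ] (X Y : γ → ℝ) (e : γ → γ → ℝ) :
    ∑ c, ∑ d, X c * (∑ k, e c k * e d k) * Y d =
      ∑ k, (∑ c, e c k * X c) * ∑ d, e d k * Y d := by
  simp only [Finset.sum_mul_sum]
  simp only [Finset.mul_sum, Finset.sum_mul]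
  rw [Finset.sum_congr rfl fun x _ => Finset.sum_comm, Finset.sum_comm]
  exact Finset.sum_congr rfl fun k _ => Finset.sum_congr rfl fun c _ =>
    Finset.sum_congr rfl fun d _ => by ring

end Sums

/-- The matrix `E` is an orthonormal frame for the metric `g`; its columns are the frame vectors. -/
def IsFrame {d : ℕ} (g E : Matrix (Fin d) (Fin d) ℝ) : Prop := E.transpose * g * E = 1

open scoped MatrixOrder ComplexOrder in
-- Factor `g = BᵀB` with `B` invertible; the columns of `B⁻¹` are orthonormal.
theorem exists_isFrame {d : ℕ} {g : Matrix (Fin d) (Fin d) ℝ} (hg : g.PosDef) :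
    ∃ E, IsFrame g E := by
  obtain ⟨B, hB, rfl⟩ := CStarAlgebra.isStrictlyPositive_iff_eq_star_mul_self.mp
    hg.isStrictlyPositive
  have h1 : B * B⁻¹ = 1 := Matrix.mul_nonsing_inv _ ((Matrix.isUnit_iff_isUnit_det B).1 hB)
  refine ⟨B⁻¹, ?_⟩
  rw [IsFrame, Matrix.star_eq_conjTranspose, Matrix.conjTranspose_eq_transpose_of_trivial,
    mul_assoc, mul_assoc, h1, mul_one, ← Matrix.transpose_mul, h1, Matrix.transpose_one]

theorem IsFrame.inv_eq {d : ℕ} {g E : Matrix (Fin d) (Fin d) ℝ} (h : IsFrame g E) :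
    g⁻¹ = E * E.transpose :=
  Matrix.inv_eq_left_inv (by rw [mul_assoc]; exact mul_eq_one_comm.1 h)

theorem IsFrame.inv_apply {d : ℕ} {g E : Matrix (Fin d) (Fin d) ℝ} (h : IsFrame g E)
    (i j : Fin d) : g⁻¹ i j = ∑ k, E i k * E j k := by
  simp [h.inv_eq, Matrix.mul_apply]

/-- The components of a covariant tensor in a frame. -/
noncomputable def frameComp {d r : ℕ} (E : Matrix (Fin d) (Fin d) ℝ) (T : (Fin r → Fin d) → ℝ)
    (K : Fin r → Fin d) : ℝ := ∑ I, (∏ s, E (I s) (K s)) * T I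

/-- Inserting `g⁻¹ = E Eᵀ` for every index pair and expanding the product turns the double sum into
a sum of squares over frame multi-indices. -/
theorem IsFrame.tensorNorm_eq {d r : ℕ} {g E : Matrix (Fin d) (Fin d) ℝ} (h : IsFrame g E)
    (T : (Fin r → Fin d) → ℝ) : tensorNorm g T = Real.sqrt (∑ K, frameComp E T K ^ 2) := by
  rw [tensorNorm]
  congr 1
  have h1 : ∀ I J : Fin r → Fin d, ∏ s, g⁻¹ (I s) (J s) =
      ∑ K : Fin r → Fin d, (∏ s, E (I s) (K s)) * ∏ s, E (J s) (K s) := fun I J => by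
    simp only [h.inv_apply, Finset.prod_univ_sum, Fintype.piFinset_univ, Finset.prod_mul_distrib]
  have h2 : ∀ K, frameComp E T K ^ 2 =
      ∑ I, ∑ J, (∏ s, E (I s) (K s)) * T I * ((∏ s, E (J s) (K s)) * T J) := fun K => by
    rw [sq, frameComp, Finset.sum_mul_sum]
  simp only [h1, h2, Finset.sum_mul]
  rw [Finset.sum_congr rfl fun I _ => Finset.sum_comm, Finset.sum_comm]
  exact Finset.sum_congr rfl fun K _ => Finset.sum_congr rfl fun I _ =>
    Finset.sum_congr rfl fun J _ => by ring

theorem IsFrame.sum_frameComp_sq_le {d r : ℕ} {g E : Matrix (Fin d) (Fin d) ℝ} (h : IsFrame g E)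
    {T : (Fin r → Fin d) → ℝ} {C : ℝ} (hC : tensorNorm g T ≤ C) :
    ∑ K, frameComp E T K ^ 2 ≤ C ^ 2 := by
  rw [h.tensorNorm_eq] at hC
  exact (Real.sqrt_le_iff.1 hC).2

/-- The frame of the ambient space that consists of the normal vector and of the vectors of a frame
of the boundary. -/
def adaptedFrame {n : ℕ} (ν : Fin (n + 1) → ℝ) (E : Matrix (Fin n) (Fin n) ℝ) :
    Matrix (Fin (n + 1)) (Fin (n + 1)) ℝ :=
  Matrix.of fun i => Fin.cons (ν i) fun a => pushTangent (fun e => E e a) i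

theorem adaptedFrame_zero {n : ℕ} (ν : Fin (n + 1) → ℝ) (E : Matrix (Fin n) (Fin n) ℝ)
    (i : Fin (n + 1)) : adaptedFrame ν E i 0 = ν i := rfl

theorem adaptedFrame_succ {n : ℕ} (ν : Fin (n + 1) → ℝ) (E : Matrix (Fin n) (Fin n) ℝ)
    (i : Fin (n + 1)) (a : Fin n) :
    adaptedFrame ν E i a.succ = pushTangent (fun e => E e a) i := rfl

/-- The Gram matrix is block diagonal: `ν` is a unit vector orthogonal to the boundary, and the
other block is that of the boundary frame. -/
theorem IsMetricOn.isFrame_adaptedFrame {n : ℕ} {U : Set (Coord (n + 1))}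
    {g : Coord (n + 1) → Matrix (Fin (n + 1)) (Fin (n + 1)) ℝ} {z : Coord n}
    (h : IsMetricOn (halfSpace n) U g) (hz : bdryIncl z ∈ U) {E : Matrix (Fin n) (Fin n) ℝ}
    (hE : IsFrame (bdryMetric g z) E) :
    IsFrame (g (bdryIncl z)) (adaptedFrame (normal g z) E) := by
  have hmem := mem_of_bdryIncl_mem hz
  have hsymm : (g (bdryIncl z)).transpose = g (bdryIncl z) := by
    ext i j
    exact h.symm hmem j i
  have hform : ∀ p q, ((adaptedFrame (normal g z) E).transpose * g (bdryIncl z) *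
      adaptedFrame (normal g z) E) p q = ∑ j, adaptedFrame (normal g z) E j p *
        ∑ i, g (bdryIncl z) j i * adaptedFrame (normal g z) E i q := fun p q => by
    rw [mul_assoc]
    simp [Matrix.mul_apply]
  have h01 : ∀ a, ∑ j, adaptedFrame (normal g z) E j (Fin.succ a) *
      ∑ i, g (bdryIncl z) j i * adaptedFrame (normal g z) E i 0 = 0 := fun a => by
    simp only [adaptedFrame_zero, adaptedFrame_succ, sum_pushTangent_mul,
      h.metric_tangent_normal hz, mul_zero, Finset.sum_const_zero]
  have htr : ((adaptedFrame (normal g z) E).transpose * g (bdryIncl z) *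
      adaptedFrame (normal g z) E).transpose = (adaptedFrame (normal g z) E).transpose *
        g (bdryIncl z) * adaptedFrame (normal g z) E := by
    rw [Matrix.transpose_mul, Matrix.transpose_mul, Matrix.transpose_transpose, hsymm, mul_assoc]
  ext p q
  refine Fin.cases ?_ (fun a => ?_) p <;> refine Fin.cases ?_ (fun b => ?_) q
  · rw [hform]
    simpa only [adaptedFrame_zero, Matrix.one_apply_eq] using h.metric_normal_normal hz
  · rw [← htr, Matrix.transpose_apply, hform, h01, Matrix.one_apply_ne (Fin.succ_ne_zero b).symm]
  · rw [hform, h01, Matrix.one_apply_ne (Fin.succ_ne_zero a)]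
  · have h2 := congrFun (congrFun hE a) b
    rw [mul_assoc] at h2
    simp only [Matrix.mul_apply, Matrix.transpose_apply, bdryMetric, Matrix.of_apply] at h2
    rw [hform]
    simp only [adaptedFrame_succ, sum_pushTangent_mul, sum_mul_pushTangent, h2, Matrix.one_apply,
      Fin.succ_inj]

/-! ### Frame components and norms of mixed tensors -/

namespace MixedTensor

variable {n a b a' b' r : ℕ}

/-- The components of a mixed tensor in frames. -/
noncomputable def inFrame (E : Matrix (Fin (n + 1)) (Fin (n + 1)) ℝ) (Eb : Matrix (Fin n) (Fin n) ℝ)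
    (T : MixedTensor n a b) : MixedTensor n a b := fun K L =>
  ∑ I, ∑ J, (∏ s, E (I s) (K s)) * (∏ s, Eb (J s) (L s)) * T I J

/-- The sum of the squares of the components. -/
def normSq (T : MixedTensor n a b) : ℝ := ∑ I, ∑ J, T I J ^ 2

theorem normSq_nonneg (T : MixedTensor n a b) : 0 ≤ T.normSq :=
  Finset.sum_nonneg fun _ _ => Finset.sum_nonneg fun _ _ => sq_nonneg _

theorem normSq_prod (T : MixedTensor n a b) (T' : MixedTensor n a' b') :
    (T.prod T').normSq = T.normSq * T'.normSq := by
  simp only [normSq, sum_fin_add_eq_sum_append, MixedTensor.prod, Fin.append_left, Fin.append_right,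
    Finset.sum_mul_sum, mul_pow]

theorem normSq_permute (σ : Equiv.Perm (Fin a)) (τ : Equiv.Perm (Fin b)) (T : MixedTensor n a b) :
    (T.permute σ τ).normSq = T.normSq := by
  refine (sum_comp_perm σ fun I => ∑ J : Fin b → Fin n, T I (fun i => J (τ i)) ^ 2).trans ?_
  exact Finset.sum_congr rfl fun I _ => sum_comp_perm τ fun J => T I J ^ 2

/-- The components with last ambient index `0`, the normal direction of an adapted frame, are
dropped. -/
theorem normSq_restrictLast_le (T : MixedTensor n (a + 1) b) :
    T.restrictLast.normSq ≤ T.normSq := by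
  simp only [normSq, sum_fin_succ_eq_sum_snoc, restrictLast, Fin.snoc_last, Fin.snoc_castSucc]
  refine Finset.sum_le_sum fun I _ => ?_
  rw [Finset.sum_comm, Fin.sum_univ_succ]
  exact le_add_of_nonneg_left (Finset.sum_nonneg fun _ _ => sq_nonneg _)

theorem normSq_snoc_zero_le (T : MixedTensor n (a + 1) b) :
    normSq (fun I J => T (Fin.snoc I 0) J : MixedTensor n a b) ≤ T.normSq := by
  simp only [normSq, sum_fin_succ_eq_sum_snoc]
  exact Finset.sum_le_sum fun I _ => Finset.single_le_sum
    (f := fun i => ∑ J, T (Fin.snoc I i) J ^ 2)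
    (fun _ _ => Finset.sum_nonneg fun _ _ => sq_nonneg _) (Finset.mem_univ 0)

/-- Cauchy–Schwarz in the contracted index, for each choice of the free indices. -/
theorem normSq_contractLast_le (T : MixedTensor n a (b + 1)) (A : (Fin (r + 1) → Fin n) → ℝ) :
    (T.contractLast fun c K => A (Fin.cons c K)).normSq ≤ T.normSq * ∑ K, A K ^ 2 := by
  have hA : ∑ K, A K ^ 2 = ∑ K : Fin r → Fin n, ∑ c, A (Fin.cons c K) ^ 2 := by
    rw [← (Fin.consEquiv fun _ => Fin n).sum_comp, Fintype.sum_prod_type, Finset.sum_comm]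
    rfl
  rw [hA]
  simp only [normSq, sum_fin_add_eq_sum_append (p := r), sum_fin_succ_eq_sum_snoc (m := b),
    contractLast, Fin.append_left, Fin.append_right, Finset.sum_mul]
  refine Finset.sum_le_sum fun I _ => Finset.sum_le_sum fun J _ => ?_
  rw [← Finset.sum_mul, Finset.mul_sum]
  exact Finset.sum_le_sum fun K _ => Finset.sum_mul_sq_le_sq_mul_sq _ _ _

theorem normSq_add_le (T T' : MixedTensor n a b) :
    (T + T').normSq ≤ 2 * T.normSq + 2 * T'.normSq := by
  simp only [normSq, Finset.mul_sum, ← Finset.sum_add_distrib]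
  refine Finset.sum_le_sum fun I _ => Finset.sum_le_sum fun J _ => ?_
  simp only [Pi.add_apply]
  nlinarith [sq_nonneg (T I J - T' I J)]

theorem normSq_smul (c : ℝ) (T : MixedTensor n a b) : (c • T).normSq = c ^ 2 * T.normSq := by
  simp only [normSq, Finset.mul_sum, Pi.smul_apply, smul_eq_mul, mul_pow]

section InFrame

variable (E : Matrix (Fin (n + 1)) (Fin (n + 1)) ℝ) (Eb : Matrix (Fin n) (Fin n) ℝ)

theorem inFrame_add_smul (c : ℝ) (T T' : MixedTensor n a b) :
    (c • T + T').inFrame E Eb = c • T.inFrame E Eb + T'.inFrame E Eb := by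
  funext K L
  simp only [inFrame, Pi.add_apply, Pi.smul_apply, smul_eq_mul, mul_add, Finset.sum_add_distrib,
    Finset.mul_sum, mul_left_comm _ c]

theorem inFrame_prod (T : MixedTensor n a b) (T' : MixedTensor n a' b') :
    (T.prod T').inFrame E Eb = (T.inFrame E Eb).prod (T'.inFrame E Eb) := by
  funext K L
  simp only [inFrame, sum_fin_add_eq_sum_append, MixedTensor.prod, Fin.append_left,
    Fin.append_right, Finset.sum_mul_sum, Fin.prod_univ_add]
  exact Finset.sum_congr rfl fun I _ => Finset.sum_congr rfl fun I' _ =>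
    Finset.sum_congr rfl fun J _ => Finset.sum_congr rfl fun J' _ => by ring

theorem inFrame_permute (σ : Equiv.Perm (Fin a)) (τ : Equiv.Perm (Fin b))
    (T : MixedTensor n a b) :
    (T.permute σ τ).inFrame E Eb = (T.inFrame E Eb).permute σ τ := by
  funext K L
  simp only [inFrame, permute]
  have h1 : ∀ I : Fin a → Fin (n + 1), ∏ s, E (I s) (K s) = ∏ s, E (I (σ s)) (K (σ s)) :=
    fun I => (Equiv.prod_comp σ fun s => E (I s) (K s)).symm
  have h2 : ∀ J : Fin b → Fin n, ∏ s, Eb (J s) (L s) = ∏ s, Eb (J (τ s)) (L (τ s)) :=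
    fun J => (Equiv.prod_comp τ fun s => Eb (J s) (L s)).symm
  simp only [h1, h2]
  refine (sum_comp_perm σ fun I => ∑ J : Fin b → Fin n, (∏ s, E (I s) (K (σ s))) *
    (∏ s, Eb (J (τ s)) (L (τ s))) * T I (fun i => J (τ i))).trans ?_
  exact Finset.sum_congr rfl fun I _ => sum_comp_perm τ fun J => (∏ s, E (I s) (K (σ s))) *
    (∏ s, Eb (J s) (L (τ s))) * T I J

/-- Holds because the columns of the adapted frame after the first are the vectors of the boundary
frame. -/
theorem inFrame_restrictLast (ν : Fin (n + 1) → ℝ) (T : MixedTensor n (a + 1) b) :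
    T.restrictLast.inFrame (adaptedFrame ν Eb) Eb =
      (T.inFrame (adaptedFrame ν Eb) Eb).restrictLast := by
  funext K L
  simp only [inFrame, restrictLast, sum_fin_succ_eq_sum_snoc, Fin.prod_univ_castSucc (n := a),
    Fin.prod_univ_castSucc (n := b), Fin.snoc_last, Fin.snoc_castSucc, adaptedFrame_succ]
  refine Finset.sum_congr rfl fun I _ => ?_
  rw [Finset.sum_comm (s := (Finset.univ : Finset (Fin (n + 1))))]
  refine Finset.sum_congr rfl fun J _ => ?_
  have h1 := sum_pushTangent_mul (fun i => (∏ s, adaptedFrame ν Eb (I s) (K s)) *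
    (∏ s : Fin b, Eb (J s) (L s.castSucc)) * T (Fin.snoc I i) J) fun e => Eb e (L (Fin.last b))
  calc _ = ∑ e, Eb e (L (Fin.last b)) * ((∏ s, adaptedFrame ν Eb (I s) (K s)) *
        (∏ s : Fin b, Eb (J s) (L s.castSucc)) * T (Fin.snoc I e.succ) J) :=
        Finset.sum_congr rfl fun e _ => by ring
    _ = _ := h1.symm
    _ = _ := Finset.sum_congr rfl fun i _ => by ring

theorem inFrame_contractVector (ν : Fin (n + 1) → ℝ) (T : MixedTensor n (a + 1) b) :
    (T.contractVector ν).inFrame (adaptedFrame ν Eb) Eb =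
      fun K L => T.inFrame (adaptedFrame ν Eb) Eb (Fin.snoc K 0) L := by
  funext K L
  simp only [inFrame, contractVector, sum_fin_succ_eq_sum_snoc, Fin.prod_univ_castSucc (n := a),
    Fin.snoc_last, Fin.snoc_castSucc, adaptedFrame_zero, Finset.mul_sum]
  refine Finset.sum_congr rfl fun I _ => ?_
  rw [Finset.sum_comm]
  exact Finset.sum_congr rfl fun J _ => Finset.sum_congr rfl fun i _ => by ring

/-- In an orthonormal frame raising an index does not change components: `gb⁻¹ = Eb Ebᵀ` makes the
metric contraction a plain sum over frame indices. -/
theorem inFrame_contractLast_sharp {gb : Matrix (Fin n) (Fin n) ℝ} (hEb : IsFrame gb Eb)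
    (T : MixedTensor n a (b + 1)) (S : (Fin (r + 1) → Fin n) → ℝ) :
    (T.contractLast (sharp gb S)).inFrame E Eb =
      (T.inFrame E Eb).contractLast fun c K => frameComp Eb S (Fin.cons c K) := by
  funext K L
  set L₁ := fun i => L (Fin.castAdd r i) with hL₁
  set L₂ := fun i => L (Fin.natAdd b i) with hL₂
  -- `X` and `Y` are `T` and `S` with all entries in frame components except the contracted one,
  -- which stays in coordinates.
  let X : Fin n → ℝ := fun c => ∑ I, ∑ J, (∏ s, E (I s) (K s)) * (∏ s, Eb (J s) (L₁ s)) *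
    T I (Fin.snoc J c)
  let Y : Fin n → ℝ := fun d => ∑ J, (∏ s, Eb (J s) (L₂ s)) * S (Fin.cons d J)
  have hX : ∀ k, T.inFrame E Eb K (Fin.snoc L₁ k) = ∑ c, Eb c k * X c := fun k => by
    simp only [inFrame, sum_fin_succ_eq_sum_snoc (m := b), Fin.prod_univ_castSucc (n := b),
      Fin.snoc_last, Fin.snoc_castSucc, X, Finset.mul_sum]
    rw [Finset.sum_comm (s := (Finset.univ : Finset (Fin n)))]
    refine Finset.sum_congr rfl fun I _ => ?_
    rw [Finset.sum_comm]
    exact Finset.sum_congr rfl fun c _ => Finset.sum_congr rfl fun J _ => by ring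
  have hY : ∀ k, frameComp Eb S (Fin.cons k L₂) = ∑ d, Eb d k * Y d := fun k => by
    rw [frameComp, ← (Fin.consEquiv fun _ => Fin n).sum_comp, Fintype.sum_prod_type]
    simp only [Fin.consEquiv_apply, Fin.prod_univ_succ, Fin.cons_zero, Fin.cons_succ, Y,
      Finset.mul_sum, mul_assoc]
    rfl
  have hl : (T.contractLast (sharp gb S)).inFrame E Eb K L =
      ∑ c, ∑ d, X c * gb⁻¹ c d * Y d := by
    simp only [inFrame, contractLast, sum_fin_add_eq_sum_append (p := r), Fin.prod_univ_add,
      Fin.append_left, Fin.append_right, sharp, ← mul_assoc (∏ s, E _ _) (∏ s, Eb _ _)]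
    generalize gb⁻¹ = M
    exact sum_sum_sum_mul_eq (fun (I : Fin a → Fin (n + 1)) (J : Fin b → Fin n) =>
        (∏ s, E (I s) (K s)) * ∏ s, Eb (J s) (L₁ s))
      (fun J : Fin r → Fin n => ∏ s, Eb (J s) (L₂ s))
      (fun I J c => T I (Fin.snoc J c : Fin (b + 1) → Fin n)) (fun c d => M c d)
      fun d J => S (Fin.cons d J : Fin (r + 1) → Fin n)
  rw [hl]
  simp only [contractLast, ← hL₁, ← hL₂, hX, hY, hEb.inv_apply]
  exact sum_sum_mul_sum_mul_eq X Y Eb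

end InFrame

end MixedTensor

/-- The norms of the derivatives up to order `k` of the curvature and of the second fundamental
form are bounded by `C` at the boundary point `z`. -/
structure NablaBounds {n : ℕ} (g : Coord (n + 1) → Matrix (Fin (n + 1)) (Fin (n + 1)) ℝ)
    (z : Coord n) (k : ℕ) (C : ℝ) : Prop where
  curvature_le : ∀ j ≤ k, tensorNorm (g (bdryIncl z))
    (nablaCurvature (halfSpace n) g j (bdryIncl z)) ≤ C
  secondFF_le : ∀ j ≤ k, tensorNorm (bdryMetric g z) (nablaSecondFF g j z) ≤ C

/-- A bound for the norm of the family in terms of `C` whenever the derivatives up to order `k` of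
the curvature and of the second fundamental form are bounded by `C`. -/
def IsNormBound (k : ℕ) (C : ℝ) {a b : ℕ} (F : MixedFamily a b) (D : ℝ) : Prop :=
  ∀ (n : ℕ) (U : Set (Coord (n + 1)))
    (g : Coord (n + 1) → Matrix (Fin (n + 1)) (Fin (n + 1)) ℝ), IsMetricOn (halfSpace n) U g →
    ∀ z : Coord n, bdryIncl z ∈ U → ∀ E, IsFrame (bdryMetric g z) E → NablaBounds g z k C →
    ((F n g z).inFrame (adaptedFrame (normal g z) E) E).normSq ≤ D

theorem normSq_inFrame_ambient {n r : ℕ} (E : Matrix (Fin (n + 1)) (Fin (n + 1)) ℝ)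
    (Eb : Matrix (Fin n) (Fin n) ℝ) (T : (Fin r → Fin (n + 1)) → ℝ) :
    normSq (inFrame E Eb (fun I _ => T I : MixedTensor n r 0)) = ∑ K, frameComp E T K ^ 2 := by
  simp [normSq, inFrame, frameComp]

theorem normSq_inFrame_bdry {n r : ℕ} (E : Matrix (Fin (n + 1)) (Fin (n + 1)) ℝ)
    (Eb : Matrix (Fin n) (Fin n) ℝ) (T : (Fin r → Fin n) → ℝ) :
    normSq (inFrame E Eb (fun _ J => T J : MixedTensor n 0 r)) = ∑ K, frameComp Eb T K ^ 2 := by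
  simp [normSq, inFrame, frameComp]

/-! ### Norm bounds for formal expressions -/

namespace TensorExpr

variable {k a b : ℕ} {C D : ℝ}

theorem isNormBound_restrict {t : TensorExpr k (a + 1) b}
    (ht : IsNormBound k C (fun _ g z => t.eval g z) D) :
    IsNormBound k C (fun _ g z => (restrict t).eval g z) D := fun n U g h z hz E hE hC => by
  beta_reduce
  rw [eval_restrict, inFrame_restrictLast]
  exact (normSq_restrictLast_le _).trans (ht n U g h z hz E hE hC)

theorem isNormBound_contractBdry {j : ℕ} {hj : j + 1 < k} {t : TensorExpr k a (b + 1)}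
    (ht : IsNormBound k C (fun _ g z => t.eval g z) D) :
    IsNormBound k C (fun _ g z => (contractBdry j hj t).eval g z) (D * C ^ 2) :=
  fun n U g h z hz E hE hC => by
  beta_reduce
  rw [eval_contractBdry, inFrame_contractLast_sharp _ _ hE]
  have h1 := ht n U g h z hz E hE hC
  exact (normSq_contractLast_le _ _).trans (mul_le_mul h1
    (hE.sum_frameComp_sq_le (hC.secondFF_le j (by omega)))
    (Finset.sum_nonneg fun _ _ => sq_nonneg _) ((normSq_nonneg _).trans h1))

/-- Each constructor bounds its squared norm by those of its parts: each block `∇ʲ R`, `∇̄ʲ l` or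
`(∇̄ʲ l)^{*₁}` costs a factor `C ^ 2`, and no estimate counts indices, so the dimension does not
enter. -/
theorem exists_isNormBound_eval (C : ℝ) (t : TensorExpr k a b) :
    ∃ D, IsNormBound k C (fun _ g z => t.eval g z) D := by
  induction t with
  | nablaR j hj =>
    refine ⟨C ^ 2, fun n U g h z hz E hE hC => ?_⟩
    exact (normSq_inFrame_ambient _ _ _).trans_le
      ((h.isFrame_adaptedFrame hz hE).sum_frameComp_sq_le (hC.curvature_le j hj))
  | nablaL j hj =>
    refine ⟨C ^ 2, fun n U g h z hz E hE hC => ?_⟩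
    exact (normSq_inFrame_bdry _ _ _).trans_le (hE.sum_frameComp_sq_le (hC.secondFF_le j hj))
  | tensor s t ihs iht =>
    obtain ⟨D, hD⟩ := ihs
    obtain ⟨D', hD'⟩ := iht
    refine ⟨D * D', fun n U g h z hz E hE hC => ?_⟩
    beta_reduce
    rw [eval_tensor, inFrame_prod, normSq_prod]
    have h1 := hD n U g h z hz E hE hC
    exact mul_le_mul h1 (hD' n U g h z hz E hE hC) (normSq_nonneg _) ((normSq_nonneg _).trans h1)
  | perm σ τ t ih =>
    obtain ⟨D, hD⟩ := ih
    refine ⟨D, fun n U g h z hz E hE hC => ?_⟩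
    beta_reduce
    rw [eval_perm, inFrame_permute, normSq_permute]
    exact hD n U g h z hz E hE hC
  | restrict t ih => exact ih.imp fun D => isNormBound_restrict
  | contractNormal t ih =>
    obtain ⟨D, hD⟩ := ih
    refine ⟨D, fun n U g h z hz E hE hC => ?_⟩
    beta_reduce
    rw [eval_contractNormal, inFrame_contractVector]
    exact (normSq_snoc_zero_le _).trans (hD n U g h z hz E hE hC)
  | contractAmbient j hj t ih =>
    obtain ⟨D, hD⟩ := ih
    simp only [eval_contractAmbient]
    exact ⟨D * C ^ 2, isNormBound_contractBdry (isNormBound_restrict hD)⟩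
  | contractBdry j hj t ih =>
    obtain ⟨D, hD⟩ := ih
    exact ⟨D * C ^ 2, isNormBound_contractBdry hD⟩

end TensorExpr

theorem exists_isNormBound_evalList {k a b : ℕ} (C : ℝ) (L : List (ℤ × TensorExpr k a b)) :
    ∃ D, IsNormBound k C (evalList L) D := by
  induction L with
  | nil => exact ⟨0, fun n U g h z hz E hE hC => by simp [evalList, inFrame, normSq]⟩
  | cons t L ih =>
    obtain ⟨D, hD⟩ := ih
    obtain ⟨D', hD'⟩ := t.2.exists_isNormBound_eval C
    -- The constant comes from `|x + y|² ≤ 2|x|² + 2|y|²`.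
    refine ⟨2 * ((t.1 : ℝ) ^ 2 * D') + 2 * D, fun n U g h z hz E hE hC => ?_⟩
    rw [evalList_cons, inFrame_add_smul]
    refine (normSq_add_le _ _).trans ?_
    rw [normSq_smul]
    have h1 := hD n U g h z hz E hE hC
    have h2 := hD' n U g h z hz E hE hC
    gcongr

/-- Bounds for the curvature and the second fundamental form and their derivatives give a bound for
the derivatives of the curvature of the boundary. -/
theorem exists_tensorNorm_nablaCurvature_le (k : ℕ) (C : ℝ) :
    ∃ D : ℝ, ∀ (n : ℕ) (U : Set (Coord (n + 1)))
      (g : Coord (n + 1) → Matrix (Fin (n + 1)) (Fin (n + 1)) ℝ), IsMetricOn (halfSpace n) U g →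
      ∀ z : Coord n, bdryIncl z ∈ U → NablaBounds g z k C →
      tensorNorm (bdryMetric g z) (nablaCurvature Set.univ (bdryMetric g) k z) ≤ D := by
  obtain ⟨L, -, hL⟩ := exists_evalList_nablaCurvature k
  obtain ⟨D, hD⟩ := exists_isNormBound_evalList C L
  refine ⟨Real.sqrt D, fun n U g h z hz hC => ?_⟩
  obtain ⟨E, hE⟩ := exists_isFrame (h.bdry.posDef z (IsMetricOn.mem_bdry hz))
  rw [hE.tensorNorm_eq, ← normSq_inFrame_bdry (adaptedFrame (normal g z) E) E]
  have h1 : (fun _ J => nablaCurvature Set.univ (bdryMetric g) k z J : MixedTensor n 0 (k + 4)) =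
      evalList L n g z := by
    funext I J
    exact hL n U g h z hz I J
  rw [h1]
  exact Real.sqrt_le_sqrt (hD n U g h z hz E hE hC)

/-! ### The metric in a chart of a manifold with boundary -/

section Charts

variable {n : ℕ} {M : Type*} [TopologicalSpace M]

/-- An open set of coordinates whose intersection with the half-space is the image of the chart. -/
def chartDomain (φ : OpenPartialHomeomorph M (EuclideanHalfSpace (n + 1))) : Set (Coord (n + 1)) :=
  (𝓡∂ (n + 1)).symm ⁻¹' φ.target

variable (φ : OpenPartialHomeomorph M (EuclideanHalfSpace (n + 1)))

theorem isOpen_chartDomain : IsOpen (chartDomain φ) :=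
  φ.open_target.preimage (𝓡∂ (n + 1)).continuous_symm

variable {φ} {p : M}

theorem range_eq_halfSpace : Set.range (𝓡∂ (n + 1)) = halfSpace n :=
  range_modelWithCornersEuclideanHalfSpace (n + 1)

theorem extend_target_eq : (φ.extend (𝓡∂ (n + 1))).target = halfSpace n ∩ chartDomain φ := by
  rw [OpenPartialHomeomorph.extend_target, range_eq_halfSpace, Set.inter_comm]
  rfl

theorem uniqueDiffOn_halfSpace : UniqueDiffOn ℝ (halfSpace n) := by
  rw [← range_eq_halfSpace]
  exact (𝓡∂ (n + 1)).uniqueDiffOn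

theorem extend_symm_mem_source {y : Coord (n + 1)} (hy : y ∈ halfSpace n ∩ chartDomain φ) :
    (φ.extend (𝓡∂ (n + 1))).symm y ∈ φ.source := by
  rw [← φ.extend_source (I := 𝓡∂ (n + 1))]
  exact (φ.extend (𝓡∂ (n + 1))).map_target (by rwa [extend_target_eq])

theorem extend_mem (hp : p ∈ φ.source) :
    φ.extend (𝓡∂ (n + 1)) p ∈ halfSpace n ∩ chartDomain φ := by
  rw [← extend_target_eq]
  exact (φ.extend (𝓡∂ (n + 1))).map_source (by rwa [φ.extend_source])

variable [ChartedSpace (EuclideanHalfSpace (n + 1)) M]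

theorem contMDiffOn_extend_symm_target
    (hφ : φ ∈ IsManifold.maximalAtlas (𝓡∂ (n + 1)) ∞ M) :
    ContMDiffOn 𝓘(ℝ, Coord (n + 1)) (𝓡∂ (n + 1)) ∞ (φ.extend (𝓡∂ (n + 1))).symm
      (halfSpace n ∩ chartDomain φ) := by
  rw [← extend_target_eq, OpenPartialHomeomorph.extend_target, ← (𝓡∂ (n + 1)).image_eq]
  exact contMDiffOn_extend_symm hφ

/-- Passes from the derivative within the whole half-space to the one within the chart image, the
set on which the inverse chart is smooth. -/
theorem coordVec_eq {y : Coord (n + 1)} (hy : y ∈ halfSpace n ∩ chartDomain φ) (i : Fin (n + 1)) :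
    coordVec φ i y = mfderivWithin 𝓘(ℝ, Coord (n + 1)) (𝓡∂ (n + 1)) (φ.extend (𝓡∂ (n + 1))).symm
      (halfSpace n ∩ chartDomain φ) y (EuclideanSpace.single i (1 : ℝ) : Coord (n + 1)) := by
  rw [mfderivWithin_inter ((isOpen_chartDomain φ).mem_nhds hy.2)]
  rfl

theorem mdifferentiableWithinAt_extend_symm
    (hφ : φ ∈ IsManifold.maximalAtlas (𝓡∂ (n + 1)) ∞ M) {y : Coord (n + 1)}
    (hy : y ∈ halfSpace n ∩ chartDomain φ) :
    MDifferentiableWithinAt 𝓘(ℝ, Coord (n + 1)) (𝓡∂ (n + 1)) (φ.extend (𝓡∂ (n + 1))).symm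
      (halfSpace n ∩ chartDomain φ) y :=
  (contMDiffOn_extend_symm_target hφ).mdifferentiableOn (by simp) y hy

theorem mdifferentiableAt_extend (hφ : φ ∈ IsManifold.maximalAtlas (𝓡∂ (n + 1)) ∞ M) {p : M}
    (hp : p ∈ φ.source) :
    MDifferentiableAt (𝓡∂ (n + 1)) 𝓘(ℝ, Coord (n + 1)) (φ.extend (𝓡∂ (n + 1))) p :=
  (φ.contMDiffAt_extend hφ hp).mdifferentiableAt (by simp)

/-- The differential of the chart is a left inverse, by the chain rule for the chart composed with
its inverse. -/
theorem injective_mfderivWithin_extend_symm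
    (hφ : φ ∈ IsManifold.maximalAtlas (𝓡∂ (n + 1)) ∞ M) {y : Coord (n + 1)}
    (hy : y ∈ halfSpace n ∩ chartDomain φ) :
    Function.Injective (mfderivWithin 𝓘(ℝ, Coord (n + 1)) (𝓡∂ (n + 1))
      (φ.extend (𝓡∂ (n + 1))).symm (halfSpace n ∩ chartDomain φ) y) := by
  have hu : UniqueMDiffWithinAt 𝓘(ℝ, Coord (n + 1)) (halfSpace n ∩ chartDomain φ) y :=
    ((uniqueDiffOn_halfSpace.inter (isOpen_chartDomain φ)).uniqueMDiffOn) y hy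
  have hcomp := mfderiv_comp_mfderivWithin y
    (mdifferentiableAt_extend hφ (extend_symm_mem_source hy))
    (mdifferentiableWithinAt_extend_symm hφ hy) hu
  have hid : mfderivWithin 𝓘(ℝ, Coord (n + 1)) 𝓘(ℝ, Coord (n + 1))
      (φ.extend (𝓡∂ (n + 1)) ∘ (φ.extend (𝓡∂ (n + 1))).symm) (halfSpace n ∩ chartDomain φ) y =
      ContinuousLinearMap.id ℝ _ := by
    refine (mfderivWithin_congr (f := id) (fun x hx => (φ.extend (𝓡∂ (n + 1))).right_inv
      (by rwa [extend_target_eq])) ((φ.extend (𝓡∂ (n + 1))).right_inv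
      (by rwa [extend_target_eq]))).trans (mfderivWithin_id hu)
  rw [hid] at hcomp
  intro v w hvw
  have h1 := DFunLike.congr_fun hcomp v
  have h2 := DFunLike.congr_fun hcomp w
  rw [ContinuousLinearMap.comp_apply] at h1 h2
  exact h1.trans ((congrArg _ hvw).trans h2.symm)

theorem linearIndependent_coordVec (hφ : φ ∈ IsManifold.maximalAtlas (𝓡∂ (n + 1)) ∞ M)
    {y : Coord (n + 1)} (hy : y ∈ halfSpace n ∩ chartDomain φ) :
    LinearIndependent ℝ fun i => coordVec φ i y := by
  have h1 : LinearIndependent ℝ fun i : Fin (n + 1) =>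
      (EuclideanSpace.single i (1 : ℝ) : Coord (n + 1)) := by
    have h0 : (fun i : Fin (n + 1) => (EuclideanSpace.single i (1 : ℝ) : Coord (n + 1))) =
        EuclideanSpace.basisFun (Fin (n + 1)) ℝ := by
      funext i
      simp
    rw [h0]
    exact (EuclideanSpace.basisFun (Fin (n + 1)) ℝ).orthonormal.linearIndependent
  have h2 := h1.map' (mfderivWithin 𝓘(ℝ, Coord (n + 1)) (𝓡∂ (n + 1))
      (φ.extend (𝓡∂ (n + 1))).symm (halfSpace n ∩ chartDomain φ) y).toLinearMap
    (LinearMap.ker_eq_bot.2 (injective_mfderivWithin_extend_symm hφ hy))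
  simpa only [coordVec_eq hy] using! h2

variable [IsManifold (𝓡∂ (n + 1)) ∞ M]

/-- The coordinate field is the tangent map of the inverse chart applied to a constant section. -/
theorem contMDiffOn_coordVec (hφ : φ ∈ IsManifold.maximalAtlas (𝓡∂ (n + 1)) ∞ M)
    (i : Fin (n + 1)) :
    ContMDiffOn 𝓘(ℝ, Coord (n + 1)) ((𝓡∂ (n + 1)).prod 𝓘(ℝ, EuclideanSpace ℝ (Fin (n + 1)))) ∞
      (fun y => (⟨(φ.extend (𝓡∂ (n + 1))).symm y, coordVec φ i y⟩ :
        TangentBundle (𝓡∂ (n + 1)) M)) (halfSpace n ∩ chartDomain φ) := by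
  have : IsManifold (𝓡∂ (n + 1)) 1 M := IsManifold.of_le (n := ∞) (by simp)
  have h1 := (contMDiffOn_extend_symm_target hφ).contMDiffOn_tangentMapWithin (m := ∞) (by simp)
    (uniqueDiffOn_halfSpace.inter (isOpen_chartDomain φ)).uniqueMDiffOn
  have h2 : ContMDiffOn 𝓘(ℝ, Coord (n + 1)) 𝓘(ℝ, Coord (n + 1)).tangent ∞
      (fun y => (⟨y, (EuclideanSpace.single i (1 : ℝ) : Coord (n + 1))⟩ :
        TangentBundle 𝓘(ℝ, Coord (n + 1)) (Coord (n + 1)))) (halfSpace n ∩ chartDomain φ) := by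
    intro y _
    exact contMDiffWithinAt_vectorSpace_iff_contDiffWithinAt.2 contDiffWithinAt_const
  refine (h1.comp h2 fun y hy => hy).congr fun y hy => ?_
  rw [coordVec_eq hy]
  rfl

variable [Bundle.RiemannianBundle (fun x : M => TangentSpace (𝓡∂ (n + 1)) x)]

omit [IsManifold (𝓡∂ (n + 1)) ∞ M] in
theorem posDef_chartMetric (hφ : φ ∈ IsManifold.maximalAtlas (𝓡∂ (n + 1)) ∞ M)
    {y : Coord (n + 1)} (hy : y ∈ halfSpace n ∩ chartDomain φ) : (chartMetric φ y).PosDef :=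
  Matrix.posDef_gram_iff_linearIndependent.2 (linearIndependent_coordVec hφ hy)

variable [IsContMDiffRiemannianBundle (𝓡∂ (n + 1)) ∞ (EuclideanSpace ℝ (Fin (n + 1)))
  (fun x : M => TangentSpace (𝓡∂ (n + 1)) x)]

theorem isMetricOn_chartMetric (hφ : φ ∈ IsManifold.maximalAtlas (𝓡∂ (n + 1)) ∞ M) :
    IsMetricOn (halfSpace n) (chartDomain φ) (chartMetric φ) where
  uniqueDiffOn := uniqueDiffOn_halfSpace
  isOpen := isOpen_chartDomain φ
  contDiffOn i j := contMDiffOn_iff_contDiffOn.1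
    (ContMDiffOn.inner_bundle (contMDiffOn_coordVec hφ i) (contMDiffOn_coordVec hφ j))
  posDef _ hy := posDef_chartMetric hφ hy

end Charts

/-! ### Boundary points in an arbitrary chart -/

section BoundaryPoints

variable {n : ℕ} {M : Type*} [TopologicalSpace M] [ChartedSpace (EuclideanHalfSpace (n + 1)) M]
  {φ : OpenPartialHomeomorph M (EuclideanHalfSpace (n + 1))} {p : M}

/-- If `y₀ > 0`, the inverse chart is defined on a full neighbourhood of `y` and has surjective
differential there, so it maps `y` to an interior point, contradicting `p ∈ ∂M`. -/
theorem extend_apply_zero_of_mem_boundary (hφ : φ ∈ IsManifold.maximalAtlas (𝓡∂ (n + 1)) ∞ M)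
    (hp : p ∈ φ.source) (hb : p ∈ (𝓡∂ (n + 1)).boundary M) : φ.extend (𝓡∂ (n + 1)) p 0 = 0 := by
  by_contra hne
  have hmem := extend_mem hp
  have hpos : 0 < φ.extend (𝓡∂ (n + 1)) p 0 := lt_of_le_of_ne hmem.1 (Ne.symm hne)
  set y := φ.extend (𝓡∂ (n + 1)) p with hy
  have hnhds : halfSpace n ∩ chartDomain φ ∈ nhds y := by
    refine Filter.inter_mem ?_ ((isOpen_chartDomain φ).mem_nhds hmem.2)
    have hopen : IsOpen {x : Coord (n + 1) | 0 < x 0} :=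
      isOpen_lt continuous_const (by fun_prop)
    exact Filter.mem_of_superset (hopen.mem_nhds hpos) fun x hx => le_of_lt (α := ℝ) hx
  have hsymm : (φ.extend (𝓡∂ (n + 1))).symm y = p := φ.extend_left_inv hp
  have hinj := injective_mfderivWithin_extend_symm hφ hmem
  rw [mfderivWithin_of_mem_nhds hnhds] at hinj
  let A : Coord (n + 1) →ₗ[ℝ] Coord (n + 1) := (mfderiv 𝓘(ℝ, Coord (n + 1)) (𝓡∂ (n + 1))
    (φ.extend (𝓡∂ (n + 1))).symm y).toLinearMap
  -- The tangent space of `M` is modelled on the same `ℝⁿ⁺¹`, so injectivity gives surjectivity.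
  have hsurj : Function.Surjective A := LinearMap.injective_iff_surjective.1 hinj
  have hint := MDifferentiableAt.isInteriorPoint_of_surjective_mfderiv
    ((mdifferentiableWithinAt_extend_symm hφ hmem).mdifferentiableAt hnhds) hsurj
    BoundarylessManifold.isInteriorPoint
  rw [hsymm] at hint
  exact ((𝓡∂ (n + 1)).isBoundaryPoint_iff_not_isInteriorPoint p).1 hb hint

theorem bdryIncl_bdryCoord (hφ : φ ∈ IsManifold.maximalAtlas (𝓡∂ (n + 1)) ∞ M)
    (hp : p ∈ φ.source) (hb : p ∈ (𝓡∂ (n + 1)).boundary M) :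
    bdryIncl (bdryCoord φ p) = φ.extend (𝓡∂ (n + 1)) p := by
  ext i
  refine Fin.cases ?_ (fun a => rfl) i
  exact (extend_apply_zero_of_mem_boundary hφ hp hb).symm

end BoundaryPoints

end BoundaryGeometry

/-! ### The theorem on manifolds, from the local results in a chart -/

theorem corollary2p11 (k : ℕ) :
    (∃ L : List (ℤ × BoundaryGeometry.TensorExpr k 0 (k + 4)),
      ∀ (n : ℕ) (M : Type*) [TopologicalSpace M] [ChartedSpace (EuclideanHalfSpace (n + 1)) M]
        [IsManifold (𝓡∂ (n + 1)) ∞ M]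
        [Bundle.RiemannianBundle (fun x : M => TangentSpace (𝓡∂ (n + 1)) x)]
        [IsContMDiffRiemannianBundle (𝓡∂ (n + 1)) ∞ (EuclideanSpace ℝ (Fin (n + 1)))
          (fun x : M => TangentSpace (𝓡∂ (n + 1)) x)]
        (φ : OpenPartialHomeomorph M (EuclideanHalfSpace (n + 1)))
        (_ : φ ∈ IsManifold.maximalAtlas (𝓡∂ (n + 1)) ∞ M)
        (p : M) (_ : p ∈ φ.source) (_ : p ∈ (𝓡∂ (n + 1)).boundary M) (J : Fin (k + 4) → Fin n),
        BoundaryGeometry.nablaCurvature Set.univ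
            (BoundaryGeometry.bdryMetric (BoundaryGeometry.chartMetric φ)) k
            (BoundaryGeometry.bdryCoord φ p) J =
          (L.map fun t => (t.1 : ℝ) * t.2.eval (BoundaryGeometry.chartMetric φ)
            (BoundaryGeometry.bdryCoord φ p) Fin.elim0 J).sum) ∧
    (∀ C : ℝ, ∃ D : ℝ,
      ∀ (n : ℕ) (M : Type*) [TopologicalSpace M] [ChartedSpace (EuclideanHalfSpace (n + 1)) M]
        [IsManifold (𝓡∂ (n + 1)) ∞ M]
        [Bundle.RiemannianBundle (fun x : M => TangentSpace (𝓡∂ (n + 1)) x)]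
        [IsContMDiffRiemannianBundle (𝓡∂ (n + 1)) ∞ (EuclideanSpace ℝ (Fin (n + 1)))
          (fun x : M => TangentSpace (𝓡∂ (n + 1)) x)]
        (φ : OpenPartialHomeomorph M (EuclideanHalfSpace (n + 1)))
        (_ : φ ∈ IsManifold.maximalAtlas (𝓡∂ (n + 1)) ∞ M)
        (p : M) (_ : p ∈ φ.source) (_ : p ∈ (𝓡∂ (n + 1)).boundary M),
        (∀ j ≤ k, BoundaryGeometry.tensorNorm
          (BoundaryGeometry.chartMetric φ (φ.extend (𝓡∂ (n + 1)) p))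
          (BoundaryGeometry.nablaCurvature (BoundaryGeometry.halfSpace n)
            (BoundaryGeometry.chartMetric φ) j (φ.extend (𝓡∂ (n + 1)) p)) ≤ C) →
        (∀ j ≤ k, BoundaryGeometry.tensorNorm
          (BoundaryGeometry.bdryMetric (BoundaryGeometry.chartMetric φ)
            (BoundaryGeometry.bdryCoord φ p))
          (BoundaryGeometry.nablaSecondFF (BoundaryGeometry.chartMetric φ) j
            (BoundaryGeometry.bdryCoord φ p)) ≤ C) →
        BoundaryGeometry.tensorNorm
          (BoundaryGeometry.bdryMetric (BoundaryGeometry.chartMetric φ)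
            (BoundaryGeometry.bdryCoord φ p))
          (BoundaryGeometry.nablaCurvature Set.univ
            (BoundaryGeometry.bdryMetric (BoundaryGeometry.chartMetric φ)) k
            (BoundaryGeometry.bdryCoord φ p)) ≤ D) := by

  constructor
  · obtain ⟨L, -, hL⟩ := BoundaryGeometry.exists_evalList_nablaCurvature k
    refine ⟨L, fun n M _ _ _ _ _ φ hφ p hp hb J => ?_⟩
    have hmem : BoundaryGeometry.bdryIncl (BoundaryGeometry.bdryCoord φ p) ∈
        BoundaryGeometry.chartDomain φ := by
      rw [BoundaryGeometry.bdryIncl_bdryCoord hφ hp hb]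
      exact (BoundaryGeometry.extend_mem hp).2
    rw [hL n _ _ (BoundaryGeometry.isMetricOn_chartMetric hφ) _ hmem Fin.elim0 J]
    exact BoundaryGeometry.evalList_apply L n _ _ _ _
  · intro C
    obtain ⟨D, hD⟩ := BoundaryGeometry.exists_tensorNorm_nablaCurvature_le k C
    refine ⟨D, fun n M _ _ _ _ _ φ hφ p hp hb hR hl => ?_⟩
    rw [← BoundaryGeometry.bdryIncl_bdryCoord hφ hp hb] at hR
    have hmem : BoundaryGeometry.bdryIncl (BoundaryGeometry.bdryCoord φ p) ∈
        BoundaryGeometry.chartDomain φ := by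
      rw [BoundaryGeometry.bdryIncl_bdryCoord hφ hp hb]
      exact (BoundaryGeometry.extend_mem hp).2
    exact hD n _ _ (BoundaryGeometry.isMetricOn_chartMetric hφ) _ hmem ⟨hR, hl⟩
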